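/- Let $(X,d)$ be a compact metric space and $\mu_0$ a Borel probability measure on $X$ whose support is all of $X$. For $N\ge 1$ let $H^{(N)}:X^N\to\mathbb{R}$ be a symmetric function (invariant under permutations of the $N$ variables). Assume that $H^{(N)}/N$ is uniformly bounded, i.e. $\sup_{N}\sup_{X^N}|H^{(N)}|/N<\infty$, and equicontinuous, i.e. for every $\epsilon>0$ there is $\delta>0$ such that for all $N$ and all $x,y\in X^N$: $\frac1N\sum_{i=1}^N d(x_i,y_i)\le\delta$ implies $\frac1N|H^{(N)}(x)-H^{(N)}(y)|\le\epsilon$. Let $\mathcal{M}_1(X)$ be the space of Borel probability measures on $X$ with the weak topology, let $\delta_N:X^N\to\mathcal{M}_1(X)$, $\delta_N(x)=\frac1N\sum_{i=1}^N\delta_{x_i}$, be the empirical measure, and for real $b$ let $\Gamma_{N,b}:=(\delta_N)_*\big(e^{-bH^{(N)}}\mu_0^{\otimes N}\big)$, a (not normalized) finite measure on $\mathcal{M}_1(X)$. For $\mu\in\mathcal{M}_1(X)$ let $D_{\mu_0}(\mu)=\int_X\log\frac{d\mu}{d\mu_0}\,d\mu$ if $\mu\ll\mu_0$ and $D_{\mu_0}(\mu)=+\infty$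 otherwise. Say that finite Borel measures $\Gamma_N$ on $\mathcal{M}_1(X)$ satisfy a large deviation principle (LDP) with speed $r_N>0$ and rate functional $I$ if $I:\mathcal{M}_1(X)\to(-\infty,+\infty]$ is lower semicontinuous and $\limsup_{N\to\infty}\frac{1}{r_N}\log\Gamma_N(F)\le-\inf_{F}I$, $\liminf_{N\to\infty}\frac{1}{r_N}\log\Gamma_N(G)\ge-\inf_{G}I$ for all closed $F$ and all open $G$ in $\mathcal{M}_1(X)$. Let $\beta_N>0$ be a sequence with $\beta_N\to\infty$, and assume that $\Gamma_{N,\beta_N}$ satisfies an LDP with speed $\beta_N N$ and rate functional $E$. Then for any fixed real $\beta\neq0$: if $\beta>0$, the measures $\Gamma_{N,\beta}$ satisfy an LDP with speed $\beta N$ and rate functional $E+\frac1\beta D_{\mu_0}$; if $\beta<0$, they satisfy an LDP with speed $|\beta|N$ and rate functional $-\big(E+\frac1\beta D_{\mu_0}\big)=-E+\frac1{|\beta|}D_{\mu_0}$. (In both cases this is the same as an LDP with speed $N$ and rate functional $\beta E+D_{\mu_0}$.) -/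

import Mathlib

open MeasureTheory Filter Topology
open scoped ENNReal

namespace GibbsLDP

theorem measurable_integral_continuousMap {X : Type*} [TopologicalSpace X] [CompactSpace X]
    [MeasurableSpace X] [BorelSpace X] (f : C(X, ℝ)) :
    Measurable (fun μ : ProbabilityMeasure X => ∫ x, f x ∂(μ : Measure X)) := by
  have key : (fun μ : ProbabilityMeasure X => ∫ x, f x ∂(μ : Measure X)) = fun μ : ProbabilityMeasure X =>
      (∫⁻ x, ENNReal.ofReal (f x) ∂(μ : Measure X)).toReal
        - (∫⁻ x, ENNReal.ofReal (-(f x)) ∂(μ : Measure X)).toReal := by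
    funext μ
    exact integral_eq_lintegral_pos_part_sub_lintegral_neg_part
      (Continuous.integrable_of_hasCompactSupport f.continuous (HasCompactSupport.of_compactSpace _))
  have hval : Measurable (fun μ : ProbabilityMeasure X => (μ : Measure X)) :=
    measurable_subtype_coe
  rw [key]
  refine Measurable.sub (Measurable.ennreal_toReal ?_) (Measurable.ennreal_toReal ?_)
  · exact (Measure.measurable_lintegral
      (f.continuous.measurable.ennreal_ofReal)).comp hval
  · exact (Measure.measurable_lintegral
      (f.continuous.measurable.neg.ennreal_ofReal)).comp hval

/-- On a compact metric space, the weakly open sets of probability measures belong to the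
σ-algebra which Mathlib puts on `ProbabilityMeasure X` (generated by the evaluations on
measurable sets). -/
instance opensMeasurableSpace_probabilityMeasure {X : Type*} [MetricSpace X] [CompactSpace X]
    [MeasurableSpace X] [BorelSpace X] : OpensMeasurableSpace (ProbabilityMeasure X) := by
  obtain ⟨s, hsc, hsd⟩ := TopologicalSpace.exists_countable_dense C(X, ℝ)
  have : Countable s := hsc
  let Φ : ProbabilityMeasure X → (s → ℝ) := fun μ f => ∫ x, (f : C(X, ℝ)) x ∂(μ : Measure X)
  have hΦc : Continuous Φ := continuous_pi fun f =>
    ProbabilityMeasure.continuous_integral_continuousMap (f : C(X, ℝ))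
  have hΦm : Measurable Φ := measurable_pi_lambda _ fun f =>
    measurable_integral_continuousMap (f : C(X, ℝ))
  have hint : ∀ (μ : ProbabilityMeasure X) (f : C(X, ℝ)), Integrable f (μ : Measure X) :=
    fun μ f => Continuous.integrable_of_hasCompactSupport f.continuous
      (HasCompactSupport.of_compactSpace _)
  have hcont : ∀ μ : ProbabilityMeasure X,
      Continuous fun f : C(X, ℝ) => ∫ x, f x ∂(μ : Measure X) := by
    intro μ
    refine LipschitzWith.continuous (K := 1) (LipschitzWith.of_dist_le_mul fun f g => ?_)
    rw [dist_eq_norm, ← integral_sub (hint μ f) (hint μ g), NNReal.coe_one, one_mul]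
    refine (norm_integral_le_of_norm_le_const (C := dist f g)
      (Eventually.of_forall fun x => ?_)).trans (by simp)
    rw [← dist_eq_norm]
    exact ContinuousMap.dist_apply_le_dist x
  have hΦi : Function.Injective Φ := by
    intro μ ν h
    have heq : (fun f : C(X, ℝ) => ∫ x, f x ∂(μ : Measure X))
        = fun f : C(X, ℝ) => ∫ x, f x ∂(ν : Measure X) :=
      Continuous.ext_on hsd (hcont μ) (hcont ν) fun f hf => congrFun h ⟨f, hf⟩
    refine ProbabilityMeasure.toMeasure_injective ?_
    refine ext_of_forall_integral_eq_of_IsFiniteMeasure fun f => ?_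
    exact congrFun heq f.toContinuousMap
  have hemb : IsEmbedding Φ := (hΦc.isClosedEmbedding hΦi).isEmbedding
  refine ⟨MeasurableSpace.generateFrom_le fun U hU => ?_⟩
  obtain ⟨V, hV, rfl⟩ := hemb.isInducing.isOpen_iff.1 hU
  exact hΦm hV.measurableSet

/-- The empirical measure `δ_N(x) = (1/N) ∑ i, δ_{x i}` of a nonempty finite configuration. -/
noncomputable def empiricalMeasure {X : Type*} [MeasurableSpace X] {N : ℕ} [NeZero N]
    (x : Fin N → X) : ProbabilityMeasure X :=
  ⟨(N : ℝ≥0∞)⁻¹ • ∑ i, Measure.dirac (x i), ⟨by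
    simp [ENNReal.inv_mul_cancel (Nat.cast_ne_zero.2 (NeZero.ne N)) (ENNReal.natCast_ne_top N)]⟩⟩

theorem measurable_empiricalMeasure {X : Type*} [MeasurableSpace X] {N : ℕ} [NeZero N] :
    Measurable (empiricalMeasure : (Fin N → X) → ProbabilityMeasure X) := by
  refine Measurable.subtype_mk (Measure.measurable_of_measurable_coe _ fun s hs => ?_)
  simp only [Measure.smul_apply, Measure.finsetSum_apply, smul_eq_mul]
  refine Measurable.const_mul (Finset.measurable_sum _ fun i _ => ?_) _
  exact (Measure.measurable_coe hs).comp (Measure.measurable_dirac.comp (measurable_pi_apply i))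

/-- The (not normalized) Gibbs measure `e^{-b H} μ₀^{⊗ N}` on `X^N`. -/
noncomputable def gibbsMeasure {X : Type*} [MeasurableSpace X] (μ₀ : Measure X) {N : ℕ}
    (H : (Fin N → X) → ℝ) (b : ℝ) : Measure (Fin N → X) :=
  (Measure.pi fun _ : Fin N => μ₀).withDensity fun x => ENNReal.ofReal (Real.exp (-(b * H x)))

/-- The push-forward `(δ_N)_* (e^{-b H} μ₀^{⊗ N})`, a measure on the space of probability
measures on `X`. -/
noncomputable def empiricalLaw {X : Type*} [MeasurableSpace X] (μ₀ : Measure X) {N : ℕ} [NeZero N]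
    (H : (Fin N → X) → ℝ) (b : ℝ) : Measure (ProbabilityMeasure X) :=
  (gibbsMeasure μ₀ H b).map empiricalMeasure

/-- Large deviation principle, along the filter `l`, for a family `Γ` of (not necessarily
normalized) Borel measures with speed `r` and rate function `I`. As the measures are not
normalized, the rate function may take values in `(-∞, ∞]`. -/
structure SatisfiesLDP {ι M : Type*} [TopologicalSpace M] [MeasurableSpace M]
    [OpensMeasurableSpace M] (l : Filter ι) (Γ : ι → Measure M) (r : ι → ℝ) (I : M → EReal) :
    Prop where
  ne_bot : ∀ m, I m ≠ ⊥
  lowerSemicontinuous : LowerSemicontinuous I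
  upper_bound : ∀ F : Set M, IsClosed F →
    limsup (fun k => ENNReal.log (Γ k F) / (r k : EReal)) l ≤ -(⨅ m ∈ F, I m)
  lower_bound : ∀ G : Set M, IsOpen G →
    -(⨅ m ∈ G, I m) ≤ liminf (fun k => ENNReal.log (Γ k G) / (r k : EReal)) l

/-- The entropy `D_{μ₀}(μ)` of `μ` relative to `μ₀`: it is `∫ log (dμ/dμ₀) dμ` if `μ ≪ μ₀`,
and `∞` otherwise. -/
noncomputable def relEntropy {X : Type*} [MeasurableSpace X] (μ₀ : Measure X)
    (μ : ProbabilityMeasure X) : EReal :=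
  ((InformationTheory.klDiv (μ : Measure X) μ₀ : ℝ≥0∞) : EReal)

end GibbsLDP

namespace GibbsLDP

theorem ennreal_log_le_coe_iff {x : ℝ≥0∞} {y : ℝ} :
    ENNReal.log x ≤ (y : EReal) ↔ x ≤ ENNReal.ofReal (Real.exp y) := by
  rw [← ENNReal.log_le_log_iff, ENNReal.log_ofReal_of_pos (Real.exp_pos y), Real.log_exp]

theorem coe_le_ennreal_log_iff {x : ℝ≥0∞} {y : ℝ} :
    (y : EReal) ≤ ENNReal.log x ↔ ENNReal.ofReal (Real.exp y) ≤ x := by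
  rw [← ENNReal.log_le_log_iff, ENNReal.log_ofReal_of_pos (Real.exp_pos y), Real.log_exp]

theorem ennreal_log_div_le_iff {x : ℝ≥0∞} {a r : ℝ} (hr : 0 < r) :
    ENNReal.log x / (r : EReal) ≤ ((-a : ℝ) : EReal) ↔
      x ≤ ENNReal.ofReal (Real.exp (-(a * r))) := by
  rw [EReal.div_le_iff_le_mul (by exact_mod_cast hr) (EReal.coe_ne_top r), ← EReal.coe_mul,
    ennreal_log_le_coe_iff, show r * -a = -(a * r) by ring]

theorem le_ennreal_log_div_iff {x : ℝ≥0∞} {a r : ℝ} (hr : 0 < r) :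
    ((-a : ℝ) : EReal) ≤ ENNReal.log x / (r : EReal) ↔
      ENNReal.ofReal (Real.exp (-(a * r))) ≤ x := by
  rw [EReal.le_div_iff_mul_le (by exact_mod_cast hr) (EReal.coe_ne_top r), ← EReal.coe_mul,
    coe_le_ennreal_log_iff, show -a * r = -(a * r) by ring]

section LDP

variable {ι M : Type*} [TopologicalSpace M] [MeasurableSpace M] [OpensMeasurableSpace M]
  {l : Filter ι} {Γ : ι → Measure M} {r : ι → ℝ} {I : M → EReal}

/-- On a closed set, a large deviation principle gives an eventual exponential upper bound. -/
theorem SatisfiesLDP.eventually_le (h : SatisfiesLDP l Γ r I) (hr : ∀ᶠ k in l, 0 < r k)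
    {F : Set M} (hF : IsClosed F) {a : ℝ} (ha : (a : EReal) < ⨅ m ∈ F, I m) :
    ∀ᶠ k in l, Γ k F ≤ ENNReal.ofReal (Real.exp (-(a * r k))) := by
  have h1 : limsup (fun k => ENNReal.log (Γ k F) / (r k : EReal)) l < ((-a : ℝ) : EReal) := by
    refine (h.upper_bound F hF).trans_lt ?_
    rw [EReal.coe_neg]
    exact EReal.neg_lt_neg_iff.2 ha
  filter_upwards [eventually_lt_of_limsup_lt h1, hr] with k hk hrk
  exact (ennreal_log_div_le_iff hrk).1 hk.le

/-- On an open set, a large deviation principle gives an eventual exponential lower bound. -/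
theorem SatisfiesLDP.eventually_ge (h : SatisfiesLDP l Γ r I) (hr : ∀ᶠ k in l, 0 < r k)
    {G : Set M} (hG : IsOpen G) {m : M} (hm : m ∈ G) {a : ℝ} (ha : I m < a) :
    ∀ᶠ k in l, ENNReal.ofReal (Real.exp (-(a * r k))) ≤ Γ k G := by
  have h1 : ((-a : ℝ) : EReal) < liminf (fun k => ENNReal.log (Γ k G) / (r k : EReal)) l := by
    refine lt_of_lt_of_le ?_ (h.lower_bound G hG)
    rw [EReal.coe_neg]
    exact EReal.neg_lt_neg_iff.2 ((iInf₂_le m hm).trans_lt ha)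
  filter_upwards [eventually_lt_of_lt_liminf h1, hr] with k hk hrk
  exact (le_ennreal_log_div_iff hrk).1 hk.le

/-- On a compact space, exponential bounds for the measures of small open sets imply a large
deviation principle. -/
theorem SatisfiesLDP.of_local [CompactSpace M] (hr : Tendsto r l atTop)
    (hbot : ∀ m, I m ≠ ⊥) (hlsc : LowerSemicontinuous I)
    (hup : ∀ m (a : ℝ), (a : EReal) < I m → ∃ U : Set M, IsOpen U ∧ m ∈ U ∧
      ∀ᶠ k in l, Γ k U ≤ ENNReal.ofReal (Real.exp (-(a * r k))))
    (hlow : ∀ m (a : ℝ), I m < a → ∀ U : Set M, IsOpen U → m ∈ U →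
      ∀ᶠ k in l, ENNReal.ofReal (Real.exp (-(a * r k))) ≤ Γ k U) :
    SatisfiesLDP l Γ r I where
  ne_bot := hbot
  lowerSemicontinuous := hlsc
  upper_bound F hF := by
    rw [EReal.le_neg]
    refine EReal.ge_of_forall_gt_iff_ge.1 fun a ha => ?_
    obtain ⟨c, hac, hc⟩ := EReal.exists_between_coe_real ha
    have hac' : a < c := by exact_mod_cast hac
    have hcov : ∃ n : ℕ, ∀ᶠ k in l, Γ k F ≤ n * ENNReal.ofReal (Real.exp (-(c * r k))) := by
      refine hF.isCompact.induction_on (p := fun s => ∃ n : ℕ, ∀ᶠ k in l,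
        Γ k s ≤ n * ENNReal.ofReal (Real.exp (-(c * r k)))) ⟨0, by simp⟩ ?_ ?_ ?_
      · rintro s t hst ⟨n, hn⟩
        exact ⟨n, hn.mono fun k hk => (measure_mono hst).trans hk⟩
      · rintro s t ⟨n, hn⟩ ⟨n', hn'⟩
        refine ⟨n + n', ?_⟩
        filter_upwards [hn, hn'] with k hk hk'
        rw [Nat.cast_add, add_mul]
        exact (measure_union_le s t).trans (add_le_add hk hk')
      · intro m hm
        obtain ⟨U, hU, hmU, hΓ⟩ := hup m c (hc.trans_le (iInf₂_le m hm))
        exact ⟨U, mem_nhdsWithin_of_mem_nhds (hU.mem_nhds hmU), 1, by simpa using hΓ⟩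
    obtain ⟨n, hn⟩ := hcov
    have hlim : Tendsto (fun k => (c - a) * r k) l atTop :=
      hr.const_mul_atTop (sub_pos.2 hac')
    rw [EReal.le_neg, ← EReal.coe_neg]
    refine limsup_le_of_le (h := ?_)
    filter_upwards [hn, hr.eventually_gt_atTop 0, hlim.eventually_ge_atTop (n : ℝ)]
      with k hk hrk hk'
    refine (ennreal_log_div_le_iff hrk).2 (hk.trans ?_)
    rw [← ENNReal.ofReal_natCast, ← ENNReal.ofReal_mul (Nat.cast_nonneg n)]
    refine ENNReal.ofReal_le_ofReal ?_
    have h1 : (n : ℝ) ≤ Real.exp ((c - a) * r k) := by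
      linarith [Real.add_one_le_exp ((c - a) * r k)]
    calc (n : ℝ) * Real.exp (-(c * r k))
        ≤ Real.exp ((c - a) * r k) * Real.exp (-(c * r k)) := by gcongr
      _ = Real.exp (-(a * r k)) := by rw [← Real.exp_add]; congr 1; ring
  lower_bound G hG := by
    rw [EReal.neg_le]
    refine le_iInf₂ fun m hm => EReal.le_of_forall_lt_iff_le.1 fun a ha => ?_
    rw [EReal.neg_le, ← EReal.coe_neg]
    refine le_liminf_of_le (h := ?_)
    filter_upwards [hlow m a ha G hG hm, hr.eventually_gt_atTop 0] with k hk hrk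
    exact (le_ennreal_log_div_iff hrk).2 hk

end LDP

section Matching

variable {X : Type*}

/-- A defect version of Hall's marriage theorem for relations on a finite type: the marriage is
extended to a permutation. -/
theorem exists_perm_card_not_le {α : Type*} [Fintype α] [DecidableEq α] (R : α → α → Prop)
    [∀ a, DecidablePred (R a)] (k : ℕ)
    (h : ∀ s : Finset α, s.card ≤ (s.biUnion fun a => Finset.univ.filter (R a)).card + k) :
    ∃ σ : Equiv.Perm α, (Finset.univ.filter fun a => ¬ R a (σ a)).card ≤ k := by
  let t : α → Finset (α ⊕ Fin k) := fun a =>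
    (Finset.univ.filter (R a)).disjSum Finset.univ
  have hall : ∀ s : Finset α, s.card ≤ (s.biUnion t).card := by
    intro s
    rcases s.eq_empty_or_nonempty with rfl | ⟨a₀, ha₀⟩
    · simp
    · have hst : s.biUnion t
          = (s.biUnion fun a => Finset.univ.filter (R a)).disjSum Finset.univ := by
        ext (x | x)
        · simp [t]
        · simpa [t] using ⟨a₀, ha₀⟩
      rw [hst, Finset.card_disjSum]
      simpa using h s
  obtain ⟨f, hf, hft⟩ := (Finset.all_card_le_biUnion_card_iff_exists_injective t).1 hall
  let g : {a // (f a).isLeft} → α := fun a => (f a).getLeft a.2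
  have hg : Function.Injective g := by
    rintro ⟨a, ha⟩ ⟨b, hb⟩ hab
    have h1 : f a = f b := by
      rw [← Sum.inl_getLeft (f a) ha, ← Sum.inl_getLeft (f b) hb]
      exact congrArg Sum.inl hab
    exact Subtype.ext (hf h1)
  let e : {a // (f a).isLeft} ≃ {b // b ∈ Set.range g} := Equiv.ofInjective g hg
  refine ⟨e.extendSubtype, ?_⟩
  have hsub : ∀ a ∈ Finset.univ.filter (fun a => ¬ R a (e.extendSubtype a)), (f a).isRight := by
    intro a ha
    by_contra hr
    have hl : (f a).isLeft := by simpa using hr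
    refine (Finset.mem_filter.1 ha).2 ?_
    rw [e.extendSubtype_apply_of_mem a hl]
    have h2 : Sum.inl ((f a).getLeft hl) ∈ t a := by
      rw [Sum.inl_getLeft]
      exact hft a
    exact (Finset.mem_filter.1 (Finset.inl_mem_disjSum.1 h2)).2
  calc (Finset.univ.filter fun a => ¬ R a (e.extendSubtype a)).card
      ≤ (Finset.univ.image (Sum.inr : Fin k → α ⊕ Fin k)).card := by
        refine Finset.card_le_card_of_injOn f (fun a ha => ?_) hf.injOn
        obtain ⟨b, hb⟩ := Sum.isRight_iff.1 (hsub a ha)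
        simp [hb]
    _ ≤ k := by simpa using Finset.card_image_le (s := Finset.univ) (f := (Sum.inr : Fin k → α ⊕ Fin k))

variable [MeasurableSpace X]

theorem empiricalMeasure_apply {N : ℕ} [NeZero N] (x : Fin N → X) {s : Set X}
    (hs : MeasurableSet s) [DecidablePred (· ∈ s)] :
    (empiricalMeasure x : Measure X) s
      = (N : ℝ≥0∞)⁻¹ * ((Finset.univ.filter fun i => x i ∈ s).card : ℝ≥0∞) := by
  change ((N : ℝ≥0∞)⁻¹ • ∑ i, Measure.dirac (x i)) s = _
  simp only [Measure.smul_apply, Measure.finsetSum_apply, smul_eq_mul]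
  congr 1
  simp [Measure.dirac_apply' _ hs, Set.indicator_apply]

theorem integral_empiricalMeasure [TopologicalSpace X] [CompactSpace X] [BorelSpace X]
    {N : ℕ} [NeZero N] (x : Fin N → X) (f : C(X, ℝ)) :
    ∫ y, f y ∂(empiricalMeasure x : Measure X) = (∑ i, f (x i)) / N := by
  change ∫ y, f y ∂((N : ℝ≥0∞)⁻¹ • ∑ i, Measure.dirac (x i)) = _
  rw [integral_smul_measure, integral_finsetSum_measure]
  · simp [integral_dirac' _ _ f.continuous.stronglyMeasurable, div_eq_inv_mul]
  · intro i _
    exact Continuous.integrable_of_hasCompactSupport f.continuous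
      (HasCompactSupport.of_compactSpace _)

end Matching

section Prokhorov

variable {X : Type*} [MetricSpace X] [MeasurableSpace X] [BorelSpace X]

/-- Two configurations whose empirical measures are close in the Lévy-Prokhorov distance agree,
up to a small average displacement, after a permutation. -/
theorem exists_perm_sum_dist_le [CompactSpace X] {N : ℕ} [NeZero N] (x y : Fin N → X) {ε : ℝ} (hε : 0 < ε)
    (h : levyProkhorovEDist (empiricalMeasure x : Measure X) (empiricalMeasure y)
      < ENNReal.ofReal ε) :
    ∃ σ : Equiv.Perm (Fin N),
      (1 / (N : ℝ)) * ∑ i, dist (x i) (y (σ i)) ≤ ε * (1 + Metric.diam (Set.univ : Set X)) := by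
  classical
  have hN : (0 : ℝ) < N := Nat.cast_pos.2 (NeZero.pos N)
  obtain ⟨σ, hσ⟩ := exists_perm_card_not_le (fun i j => dist (x i) (y j) < ε) ⌊ε * N⌋₊ (by
    intro s
    have h1 := left_measure_le_of_levyProkhorovEDist_lt h
      (B := x '' s) (s.finite_toSet.image x).measurableSet
    rw [ENNReal.toReal_ofReal hε.le, empiricalMeasure_apply x
      (s.finite_toSet.image x).measurableSet,
      empiricalMeasure_apply y Metric.isOpen_thickening.measurableSet] at h1
    set A := Finset.univ.filter fun i => x i ∈ x '' (s : Set (Fin N))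
    set B := Finset.univ.filter fun i => y i ∈ Metric.thickening ε (x '' (s : Set (Fin N)))
    have hA : s ⊆ A := fun i hi => by simpa [A] using ⟨i, hi, rfl⟩
    have hB : B ⊆ s.biUnion fun a => Finset.univ.filter fun j => dist (x a) (y j) < ε := by
      intro j hj
      simpa [B, Metric.mem_thickening_iff, dist_comm] using hj
    have h2 : (A.card : ℝ) ≤ B.card + ε * N := by
      have hN' : (N : ℝ≥0∞) = ENNReal.ofReal N := (ENNReal.ofReal_natCast N).symm
      rw [hN', ← ENNReal.ofReal_inv_of_pos hN, ← ENNReal.ofReal_natCast A.card,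
        ← ENNReal.ofReal_natCast B.card, ← ENNReal.ofReal_mul (by positivity),
        ← ENNReal.ofReal_mul (by positivity), ← ENNReal.ofReal_add (by positivity) hε.le,
        ENNReal.ofReal_le_ofReal_iff (by positivity)] at h1
      have h3 := mul_le_mul_of_nonneg_right h1 hN.le
      field_simp at h3
      linarith
    have h4 : A.card ≤ B.card + ⌊ε * N⌋₊ := by
      have h5 : (A.card : ℝ) - B.card ≤ ε * N := by linarith
      rcases le_total A.card B.card with h6 | h6
      · omega
      · rw [← Nat.cast_sub h6] at h5
        have := Nat.le_floor h5
        omega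
    exact (Finset.card_le_card hA).trans
      (h4.trans (Nat.add_le_add_right (Finset.card_le_card hB) _)))
  refine ⟨σ, ?_⟩
  set D := Metric.diam (Set.univ : Set X)
  have hD : 0 ≤ D := Metric.diam_nonneg
  have hbd : ∀ i, dist (x i) (y (σ i)) ≤ ε + if ¬ dist (x i) (y (σ i)) < ε then D else 0 := by
    intro i
    split_ifs with hi
    · linarith
    · linarith [Metric.dist_le_diam_of_mem isCompact_univ.isBounded (Set.mem_univ (x i))
        (Set.mem_univ (y (σ i)))]
  have hsum : ∑ i, dist (x i) (y (σ i)) ≤ N * ε + ε * N * D := by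
    refine (Finset.sum_le_sum fun i _ => hbd i).trans ?_
    rw [Finset.sum_add_distrib, ← Finset.sum_filter, Finset.sum_const, Finset.sum_const]
    simp only [Finset.card_univ, Fintype.card_fin, nsmul_eq_mul]
    have h6 : ((Finset.univ.filter fun i => ¬ dist (x i) (y (σ i)) < ε).card : ℝ) ≤ ε * N :=
      (Nat.cast_le.2 hσ).trans (Nat.floor_le (by positivity))
    gcongr
  rw [one_div, inv_mul_le_iff₀ hN]
  linarith

/-- Configurations which are coordinatewise close have close empirical measures. -/
theorem levyProkhorovEDist_empiricalMeasure_le {N : ℕ} [NeZero N] (x y : Fin N → X) {ε : ℝ}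
    (h : ∀ i, dist (x i) (y i) ≤ ε) :
    levyProkhorovEDist (empiricalMeasure x : Measure X) (empiricalMeasure y)
      ≤ ENNReal.ofReal ε := by
  classical
  refine levyProkhorovEDist_le_of_forall _ _ _ fun δ B hδ hδt hB => ?_
  have hlt : ∀ i, dist (x i) (y i) < δ.toReal := fun i =>
    (h i).trans_lt ((ENNReal.ofReal_lt_iff_lt_toReal (dist_nonneg.trans (h i)) hδt.ne).1 hδ)
  have key : ∀ u v : Fin N → X, (∀ i, dist (u i) (v i) < δ.toReal) →
      (empiricalMeasure u : Measure X) B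
        ≤ (empiricalMeasure v : Measure X) (Metric.thickening δ.toReal B) := by
    intro u v huv
    rw [empiricalMeasure_apply u hB, empiricalMeasure_apply v
      Metric.isOpen_thickening.measurableSet]
    gcongr with i hi
    intro hi
    exact Metric.mem_thickening_iff.2 ⟨u i, hi, by rw [dist_comm]; exact huv i⟩
  exact ⟨(key x y hlt).trans le_self_add,
    (key y x fun i => by rw [dist_comm]; exact hlt i).trans le_self_add⟩

/-- Lévy-Prokhorov balls are neighbourhoods in the weak topology. -/
theorem eventually_levyProkhorovEDist_lt [CompactSpace X] (m : ProbabilityMeasure X) {ε : ℝ} (hε : 0 < ε) :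
    ∀ᶠ ν : ProbabilityMeasure X in 𝓝 m, levyProkhorovEDist (ν : Measure X) m < ENNReal.ofReal ε := by
  have h := LevyProkhorov.continuous_ofMeasure_probabilityMeasure (Ω := X) |>.continuousAt (x := m)
  exact h.eventually (Metric.eball_mem_nhds _ (ENNReal.ofReal_pos.2 hε))

/-- Every neighbourhood in the weak topology contains a Lévy-Prokhorov ball. -/
theorem exists_levyProkhorovEDist_subset [CompactSpace X] {m : ProbabilityMeasure X} {U : Set (ProbabilityMeasure X)}
    (hU : U ∈ 𝓝 m) :
    ∃ ε : ℝ, 0 < ε ∧ ∀ ν : ProbabilityMeasure X,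
      levyProkhorovEDist (ν : Measure X) m < ENNReal.ofReal ε → ν ∈ U := by
  have h := LevyProkhorov.continuous_toMeasure_probabilityMeasure (Ω := X) |>.continuousAt
    (x := LevyProkhorov.ofMeasure m)
  obtain ⟨ε, hε, hs⟩ := Metric.mem_nhds_iff.1 (h hU)
  exact ⟨ε, hε, fun ν hν => hs (a := LevyProkhorov.ofMeasure ν) (edist_lt_ofReal.1 hν)⟩

end Prokhorov

section Product

variable {X : Type*} [MeasurableSpace X]

theorem lintegral_pi_prod (μ : Measure X) [IsProbabilityMeasure μ] {N : ℕ}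
    {f : Fin N → X → ℝ≥0∞} (hf : ∀ i, Measurable (f i)) :
    ∫⁻ x, ∏ i, f i (x i) ∂(Measure.pi fun _ : Fin N => μ) = ∏ i, ∫⁻ y, f i y ∂μ := by
  have h := (ProbabilityTheory.iIndepFun_pi (μ := fun _ : Fin N => μ) (X := f)
    fun i => (hf i).aemeasurable)
  have h2 := ProbabilityTheory.lintegral_prod_eq_prod_lintegral_of_indepFun Finset.univ
    (fun i (x : Fin N → X) => f i (x i)) h fun i => (hf i).comp (measurable_pi_apply i)
  rw [h2]
  exact Finset.prod_congr rfl fun i _ =>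
    (measurePreserving_eval (fun _ : Fin N => μ) i).lintegral_comp (hf i)

theorem pi_withDensity (μ : Measure X) [IsProbabilityMeasure μ] {g : X → ℝ≥0∞}
    (hg : Measurable g) [SigmaFinite (μ.withDensity g)] {N : ℕ} :
    (Measure.pi fun _ : Fin N => μ.withDensity g)
      = (Measure.pi fun _ : Fin N => μ).withDensity fun x => ∏ i, g (x i) := by
  refine (Measure.pi_eq fun s hs => ?_)
  rw [withDensity_apply _ (MeasurableSet.univ_pi hs), ← lintegral_indicator (MeasurableSet.univ_pi hs)]
  have h : ∀ x : Fin N → X, (Set.univ.pi s).indicator (fun x => ∏ i, g (x i)) x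
      = ∏ i, (s i).indicator g (x i) := by
    intro x
    by_cases hx : x ∈ Set.univ.pi s
    · rw [Set.indicator_of_mem hx]
      exact Finset.prod_congr rfl fun i _ => (Set.indicator_of_mem (hx i trivial) g).symm
    · rw [Set.indicator_of_notMem hx]
      obtain ⟨i, hi⟩ : ∃ i, x i ∉ s i := by simpa [Set.mem_pi] using hx
      exact (Finset.prod_eq_zero (Finset.mem_univ i) (Set.indicator_of_notMem hi g)).symm
  simp_rw [h]
  rw [lintegral_pi_prod μ fun i => hg.indicator (hs i)]
  refine Finset.prod_congr rfl fun i _ => ?_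
  rw [lintegral_indicator (hs i), withDensity_apply _ (hs i)]

theorem map_infinitePi_fin (μ : Measure X) [IsProbabilityMeasure μ] (N : ℕ) :
    (Measure.infinitePi fun _ : ℕ => μ).map (fun ω (i : Fin N) => ω i)
      = Measure.pi fun _ : Fin N => μ := by
  have h := (ProbabilityTheory.iIndepFun_infinitePi (P := fun _ : ℕ => μ)
    (X := fun _ x => x) fun _ => measurable_id).precomp (Fin.val_injective (n := N))
  rw [ProbabilityTheory.iIndepFun_iff_map_fun_eq_pi_map
    (fun i => (measurable_pi_apply _).aemeasurable)] at h
  refine h.trans ?_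
  congr 1
  funext i
  exact Measure.infinitePi_map_eval (fun _ : ℕ => μ) i

/-- The strong law of large numbers for the coordinates of an infinite product. -/
theorem strong_law_infinitePi (μ : Measure X) [IsProbabilityMeasure μ] {g : X → ℝ}
    (hgm : Measurable g) (hg : Integrable g μ) :
    ∀ᵐ ω ∂(Measure.infinitePi fun _ : ℕ => μ),
      Tendsto (fun N : ℕ+ => (∑ i : Fin N, g (ω i)) / (N : ℝ)) atTop (𝓝 (∫ x, g x ∂μ)) := by
  have hmp : ∀ i, MeasurePreserving (fun ω : ℕ → X => ω i)
      (Measure.infinitePi fun _ : ℕ => μ) μ := fun i =>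
    measurePreserving_eval_infinitePi (fun _ : ℕ => μ) i
  have hind := ProbabilityTheory.iIndepFun_infinitePi (P := fun _ : ℕ => μ)
    (X := fun _ => g) fun _ => hgm
  have h := ProbabilityTheory.strong_law_ae_real (μ := Measure.infinitePi fun _ : ℕ => μ)
    (fun i ω => g (ω i)) ((hmp 0).integrable_comp_of_integrable hg)
    (fun i j hij => hind.indepFun hij)
    (fun i => ⟨(hgm.comp (measurable_pi_apply i)).aemeasurable,
      (hgm.comp (measurable_pi_apply 0)).aemeasurable, by
        have h1 : ∀ j, Measure.map (fun ω : ℕ → X => g (ω j))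
            (Measure.infinitePi fun _ : ℕ => μ) = μ.map g := fun j => by
          refine (Measure.map_map hgm (hmp j).measurable).symm.trans ?_
          rw [(hmp j).map_eq]
        rw [h1, h1]⟩)
  have hint : ∫ ω, g (ω 0) ∂(Measure.infinitePi fun _ : ℕ => μ) = ∫ x, g x ∂μ := by
    rw [← (hmp 0).map_eq, integral_map (hmp 0).aemeasurable]
    rw [(hmp 0).map_eq]
    exact hgm.aestronglyMeasurable
  filter_upwards [h] with ω hω
  rw [← hint]
  refine (hω.comp tendsto_PNat_val_atTop_atTop).congr fun N => ?_
  simp only [Function.comp_apply, Finset.sum_range]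

end Product

section Empirical

theorem exists_le_measure_ball {X : Type*} [MetricSpace X] [CompactSpace X] [MeasurableSpace X]
    (μ₀ : Measure X) (hsupp : μ₀.support = Set.univ) {ε : ℝ}
    (hε : 0 < ε) : ∃ c : ℝ≥0∞, 0 < c ∧ ∀ x, c ≤ μ₀ (Metric.ball x ε) := by
  have hpos : ∀ x : X, ∀ r : ℝ, 0 < r → 0 < μ₀ (Metric.ball x r) := by
    intro x r hr
    have hx : x ∈ μ₀.support := hsupp ▸ Set.mem_univ x
    exact (Measure.mem_support_iff_forall x).1 hx _ (Metric.ball_mem_nhds x hr)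
  suffices ∃ c : ℝ≥0∞, 0 < c ∧ ∀ x ∈ (Set.univ : Set X), c ≤ μ₀ (Metric.ball x ε) by
    simpa using this
  refine isCompact_univ.induction_on (p := fun s => ∃ c : ℝ≥0∞, 0 < c ∧
    ∀ x ∈ s, c ≤ μ₀ (Metric.ball x ε)) ⟨1, one_pos, by simp⟩ ?_ ?_ ?_
  · rintro s t hst ⟨c, hc, h⟩
    exact ⟨c, hc, fun x hx => h x (hst hx)⟩
  · rintro s t ⟨c, hc, h⟩ ⟨c', hc', h'⟩
    refine ⟨min c c', lt_min hc hc', ?_⟩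
    rintro x (hx | hx)
    · exact (min_le_left _ _).trans (h x hx)
    · exact (min_le_right _ _).trans (h' x hx)
  · intro x _
    refine ⟨Metric.ball x (ε / 2), mem_nhdsWithin_of_mem_nhds
      (Metric.ball_mem_nhds x (by positivity)), _, hpos x (ε / 2) (by positivity), ?_⟩
    intro y hy
    refine measure_mono fun z hz => ?_
    rw [Metric.mem_ball] at *
    linarith [dist_triangle_right z y x]

variable {X : Type*} [MetricSpace X] [CompactSpace X] [MeasurableSpace X] [BorelSpace X]

theorem integrable_continuousMap (μ : Measure X) [IsFiniteMeasure μ] (f : C(X, ℝ)) :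
    Integrable f μ :=
  Continuous.integrable_of_hasCompactSupport f.continuous (HasCompactSupport.of_compactSpace _)

theorem abs_integral_sub_integral_le (μ : Measure X) [IsProbabilityMeasure μ] (f g : C(X, ℝ)) :
    |∫ x, f x ∂μ - ∫ x, g x ∂μ| ≤ dist f g := by
  rw [← integral_sub (integrable_continuousMap μ f) (integrable_continuousMap μ g),
    ← Real.norm_eq_abs]
  refine (norm_integral_le_of_norm_le_const (C := dist f g)
    (Eventually.of_forall fun x => ?_)).trans (by simp)
  rw [← dist_eq_norm]
  exact ContinuousMap.dist_apply_le_dist x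

/-- Varadarajan's theorem: the empirical measures of an i.i.d. sequence converge weakly, almost
surely, to the law of the sequence. -/
theorem ae_tendsto_empiricalMeasure (m : ProbabilityMeasure X) :
    ∀ᵐ ω ∂(Measure.infinitePi fun _ : ℕ => (m : Measure X)),
      Tendsto (fun N : ℕ+ => empiricalMeasure fun i : Fin N => ω i) atTop (𝓝 m) := by
  obtain ⟨s, hsc, hsd⟩ := TopologicalSpace.exists_countable_dense C(X, ℝ)
  have h : ∀ᵐ ω ∂(Measure.infinitePi fun _ : ℕ => (m : Measure X)), ∀ f ∈ s,
      Tendsto (fun N : ℕ+ => (∑ i : Fin N, f (ω i)) / (N : ℝ)) atTop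
        (𝓝 (∫ x, f x ∂(m : Measure X))) :=
    (ae_ball_iff hsc).2 fun f _ =>
      strong_law_infinitePi _ f.continuous.measurable (integrable_continuousMap _ f)
  filter_upwards [h] with ω hω
  rw [ProbabilityMeasure.tendsto_iff_forall_integral_tendsto]
  intro f
  rw [Metric.tendsto_nhds]
  intro ε hε
  obtain ⟨g, hgs, hfg⟩ := hsd.exists_dist_lt f.toContinuousMap (ε := ε / 3) (by positivity)
  filter_upwards [Metric.tendsto_nhds.1 (hω g hgs) (ε / 3) (by positivity)] with N hN
  rw [← integral_empiricalMeasure (fun i : Fin N => ω i) g, Real.dist_eq] at hN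
  have h1 := abs_integral_sub_integral_le (m : Measure X) f.toContinuousMap g
  have h2 := abs_integral_sub_integral_le
    (empiricalMeasure (fun i : Fin N => ω i) : Measure X) f.toContinuousMap g
  rw [Real.dist_eq]
  change |∫ x, f.toContinuousMap x ∂(empiricalMeasure (fun i : Fin N => ω i) : Measure X)
    - ∫ x, f.toContinuousMap x ∂(m : Measure X)| < ε
  rw [abs_lt] at *
  rw [abs_le] at *
  constructor <;> linarith

/-- The weak law of large numbers, for the empirical measure and one observable. -/
theorem tendsto_pi_empiricalMeasure_mem (m : ProbabilityMeasure X)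
    {U : Set (ProbabilityMeasure X)} (hU : IsOpen U) (hm : m ∈ U) {g : X → ℝ} (hgm : Measurable g)
    (hg : Integrable g (m : Measure X)) {a : ℝ} (ha : ∫ x, g x ∂(m : Measure X) < a) :
    Tendsto (fun N : ℕ+ => (Measure.pi fun _ : Fin N => (m : Measure X))
      {x | empiricalMeasure x ∈ U ∧ (∑ i, g (x i)) / (N : ℝ) < a}) atTop (𝓝 1) := by
  have hmeas : ∀ N : ℕ+, MeasurableSet
      {x : Fin N → X | empiricalMeasure x ∈ U ∧ (∑ i, g (x i)) / (N : ℝ) < a} := fun N =>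
    (measurable_empiricalMeasure hU.measurableSet).inter
      (measurableSet_lt ((Finset.measurable_sum _ fun i _ =>
        hgm.comp (measurable_pi_apply i)).div_const _) measurable_const)
  have hproj : ∀ N : ℕ+, Measurable fun (ω : ℕ → X) (i : Fin N) => ω i := fun N =>
    measurable_pi_lambda _ fun i => measurable_pi_apply _
  have h := tendsto_measure_of_ae_tendsto_indicator_of_isFiniteMeasure (L := atTop)
    (μ := Measure.infinitePi fun _ : ℕ => (m : Measure X)) (A := Set.univ)
    (As := fun N : ℕ+ => (fun (ω : ℕ → X) (i : Fin N) => ω i) ⁻¹'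
      {x : Fin N → X | empiricalMeasure x ∈ U ∧ (∑ i, g (x i)) / (N : ℝ) < a})
    MeasurableSet.univ (fun N => hproj N (hmeas N)) (by
      filter_upwards [ae_tendsto_empiricalMeasure m, strong_law_infinitePi _ hgm hg] with ω h1 h2
      filter_upwards [h1.eventually (hU.mem_nhds hm), h2.eventually (gt_mem_nhds ha)] with N h3 h4
      exact iff_of_true ⟨h3, h4⟩ trivial)
  rw [measure_univ] at h
  refine h.congr fun N => ?_
  rw [← map_infinitePi_fin, Measure.map_apply (hproj N) (hmeas N)]

theorem exists_empiricalMeasure_mem (m : ProbabilityMeasure X)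
    {U : Set (ProbabilityMeasure X)} (hU : IsOpen U) (hm : m ∈ U) :
    ∀ᶠ N : ℕ+ in atTop, ∃ x : Fin N → X, empiricalMeasure x ∈ U := by
  have h := tendsto_pi_empiricalMeasure_mem m hU hm (g := fun _ => 0) measurable_const
    (integrable_const _) (a := 1) (by simp)
  filter_upwards [h.eventually (lt_mem_nhds zero_lt_one)] with N hN
  obtain ⟨x, hx⟩ := nonempty_of_measure_ne_zero hN.ne'
  exact ⟨x, hx.1⟩

/-- If the reference measure has full support, then the empirical measure lies in a given open set
with a probability which is at least exponentially small. -/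
theorem exists_exp_le_pi_empiricalMeasure_mem (μ₀ : Measure X) [IsProbabilityMeasure μ₀]
    (hsupp : μ₀.support = Set.univ) (m : ProbabilityMeasure X)
    {U : Set (ProbabilityMeasure X)} (hU : IsOpen U) (hm : m ∈ U) :
    ∃ c : ℝ, ∀ᶠ N : ℕ+ in atTop, ENNReal.ofReal (Real.exp (-(c * N)))
      ≤ (Measure.pi fun _ : Fin N => μ₀) (empiricalMeasure ⁻¹' U) := by
  obtain ⟨ε, hε, hεU⟩ := exists_levyProkhorovEDist_subset (hU.mem_nhds hm)
  obtain ⟨c, hc, hball⟩ := exists_le_measure_ball μ₀ hsupp (ε := ε / 2) (by positivity)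
  obtain ⟨V, hV, hVo, hmV⟩ := eventually_nhds_iff.1
    (eventually_levyProkhorovEDist_lt m (ε := ε / 2) (by positivity))
  obtain ⟨x₀⟩ : Nonempty X := nonempty_of_isProbabilityMeasure μ₀
  have hct : c ≠ ∞ := ((hball x₀).trans_lt (measure_lt_top _ _)).ne
  have hc' : 0 < c.toReal := ENNReal.toReal_pos hc.ne' hct
  refine ⟨-Real.log c.toReal, ?_⟩
  filter_upwards [exists_empiricalMeasure_mem m hVo hmV] with N hN
  obtain ⟨y, hy⟩ := hN
  have hsub : Set.univ.pi (fun i => Metric.ball (y i) (ε / 2)) ⊆ empiricalMeasure ⁻¹' U := by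
    intro x hx
    refine hεU _ ((levyProkhorovEDist_triangle _ (empiricalMeasure y : Measure X) _).trans_lt ?_)
    calc _ < ENNReal.ofReal (ε / 2) + ENNReal.ofReal (ε / 2) :=
          ENNReal.add_lt_add_of_le_of_lt (levyProkhorovEDist_ne_top _ _)
            (levyProkhorovEDist_empiricalMeasure_le x y fun i =>
              (Metric.mem_ball.1 (hx i trivial)).le) (hV _ hy)
      _ = ENNReal.ofReal ε := by
          rw [← ENNReal.ofReal_add (by positivity) (by positivity), add_halves]
  refine le_trans ?_ (measure_mono hsub)
  rw [Measure.pi_pi, show -(-Real.log c.toReal * N) = N * Real.log c.toReal by ring,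
    Real.exp_nat_mul, Real.exp_log hc', ENNReal.ofReal_pow hc'.le, ENNReal.ofReal_toReal hct]
  calc c ^ (N : ℕ) = ∏ _i : Fin N, c := by simp
    _ ≤ _ := Finset.prod_le_prod' fun i _ => hball (y i)

/-- The local lower bound in Sanov's theorem. -/
theorem eventually_exp_le_pi_empiricalMeasure_mem (μ₀ : Measure X) [IsProbabilityMeasure μ₀]
    (m : ProbabilityMeasure X) {U : Set (ProbabilityMeasure X)} (hU : IsOpen U) (hm : m ∈ U)
    {a : ℝ} (ha : InformationTheory.klDiv (m : Measure X) μ₀ < ENNReal.ofReal a) :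
    ∀ᶠ N : ℕ+ in atTop, ENNReal.ofReal (Real.exp (-(a * N)))
      ≤ (Measure.pi fun _ : Fin N => μ₀) (empiricalMeasure ⁻¹' U) := by
  obtain ⟨hac, hint⟩ := InformationTheory.klDiv_ne_top_iff.1 ha.ne_top
  have hD : ∫ x, llr (m : Measure X) μ₀ x ∂(m : Measure X) < a := by
    rw [← InformationTheory.toReal_klDiv_of_measure_eq hac (by simp)]
    exact (ENNReal.lt_ofReal_iff_toReal_lt ha.ne_top).1 ha
  obtain ⟨b, hDb, hba⟩ := exists_between hD
  have hdens : (m : Measure X)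
      = μ₀.withDensity fun x => ENNReal.ofReal ((m : Measure X).rnDeriv μ₀ x).toReal := by
    rw [← Measure.withDensity_rnDeriv_eq _ _ hac]
    refine withDensity_congr_ae ?_
    rw [Measure.withDensity_rnDeriv_eq _ _ hac]
    filter_upwards [Measure.rnDeriv_lt_top (m : Measure X) μ₀] with x hx
    rw [ENNReal.ofReal_toReal hx.ne]
  have hgm : Measurable fun x => ENNReal.ofReal ((m : Measure X).rnDeriv μ₀ x).toReal := by
    fun_prop
  have hlim := tendsto_pi_empiricalMeasure_mem m hU hm (measurable_llr _ μ₀) hint hDb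
  have hexp : Tendsto (fun N : ℕ+ => (a - b) * (N : ℝ)) atTop atTop :=
    (tendsto_natCast_atTop_atTop.comp tendsto_PNat_val_atTop_atTop).const_mul_atTop
      (sub_pos.2 hba)
  filter_upwards [hlim.eventually (lt_mem_nhds ENNReal.one_half_lt_one),
    hexp.eventually_ge_atTop 1] with N hN hN'
  set A := {x : Fin N → X | empiricalMeasure x ∈ U ∧
    (∑ i, llr (m : Measure X) μ₀ (x i)) / (N : ℝ) < b}
  have hAm : MeasurableSet A := (measurable_empiricalMeasure hU.measurableSet).inter
      (measurableSet_lt ((Finset.measurable_sum _ fun i _ =>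
        (measurable_llr _ μ₀).comp (measurable_pi_apply i)).div_const _) measurable_const)
  have hNpos : (0 : ℝ) < N := by exact_mod_cast N.pos
  have hupper : (Measure.pi fun _ : Fin N => (m : Measure X)) A
      ≤ ENNReal.ofReal (Real.exp (b * N)) * (Measure.pi fun _ : Fin N => μ₀) A := by
    have : IsProbabilityMeasure
      (μ₀.withDensity fun x => ENNReal.ofReal ((m : Measure X).rnDeriv μ₀ x).toReal) := by
      rw [← hdens]; infer_instance
    have hpi := pi_withDensity μ₀ hgm (N := N)
    rw [← hdens] at hpi
    rw [hpi, withDensity_apply _ hAm, ← setLIntegral_const]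
    refine setLIntegral_mono measurable_const fun x hx => ?_
    rw [← ENNReal.ofReal_prod_of_nonneg fun i _ => ENNReal.toReal_nonneg]
    refine ENNReal.ofReal_le_ofReal ?_
    calc ∏ i, ((m : Measure X).rnDeriv μ₀ (x i)).toReal
        ≤ ∏ i, Real.exp (llr (m : Measure X) μ₀ (x i)) :=
          Finset.prod_le_prod (fun i _ => ENNReal.toReal_nonneg) fun i _ => Real.le_exp_log _
      _ = Real.exp (∑ i, llr (m : Measure X) μ₀ (x i)) := (Real.exp_sum _ _).symm
      _ ≤ Real.exp (b * N) := Real.exp_le_exp.2 ((div_lt_iff₀ hNpos).1 hx.2).le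
  have h1 : ENNReal.ofReal (Real.exp (-((a - b) * N))) ≤ 2⁻¹ := by
    rw [show (2⁻¹ : ℝ≥0∞) = ENNReal.ofReal 2⁻¹ by
      rw [ENNReal.ofReal_inv_of_pos two_pos]; simp]
    refine ENNReal.ofReal_le_ofReal ?_
    rw [Real.exp_neg]
    gcongr
    linarith [Real.add_one_le_exp ((a - b) * N)]
  have h2 : ENNReal.ofReal (Real.exp (b * N)) * ENNReal.ofReal (Real.exp (-(a * N)))
      ≤ ENNReal.ofReal (Real.exp (b * N)) * (Measure.pi fun _ : Fin N => μ₀) A := by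
    rw [← ENNReal.ofReal_mul (Real.exp_pos _).le, ← Real.exp_add,
      show b * N + -(a * N) = -((a - b) * (N : ℝ)) by ring]
    exact h1.trans (hN.le.trans hupper)
  refine le_trans ?_ (measure_mono (fun x hx => hx.1 : A ⊆ empiricalMeasure ⁻¹' U))
  exact (ENNReal.mul_le_mul_iff_right (by simp [Real.exp_pos]) ENNReal.ofReal_ne_top).1 h2

end Empirical

open InformationTheory

theorem mul_sub_exp_add_one_le_klFun {x : ℝ} (hx : 0 ≤ x) (t : ℝ) :
    x * t - Real.exp t + 1 ≤ klFun x := by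
  rw [klFun_apply]
  rcases hx.eq_or_lt with rfl | hx
  · simp [(Real.exp_pos t).le]
  · have h := mul_le_mul_of_nonneg_left (Real.add_one_le_exp (t - Real.log x)) hx.le
    rw [Real.exp_sub, Real.exp_log hx, mul_div_cancel₀ _ hx.ne'] at h
    linarith

/-- The logarithm, truncated to `[-n, n]`. -/
noncomputable def clampedLog (n : ℕ) (x : ℝ) : ℝ :=
  if x = 0 then -n else max (-n) (min n (Real.log x))

theorem measurable_clampedLog (n : ℕ) : Measurable (clampedLog n) :=
  Measurable.ite (measurableSet_singleton 0) measurable_const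
    (measurable_const.max (measurable_const.min Real.measurable_log))

theorem abs_clampedLog_le (n : ℕ) (x : ℝ) : |clampedLog n x| ≤ n := by
  have hn : (0 : ℝ) ≤ n := n.cast_nonneg
  rw [clampedLog]
  split_ifs
  · simp
  · exact abs_le.2 ⟨le_max_left _ _, max_le (by linarith) (min_le_left _ _)⟩

theorem clampedLog_young_nonneg (n : ℕ) {x : ℝ} (hx : 0 ≤ x) :
    0 ≤ x * clampedLog n x - Real.exp (clampedLog n x) + 1 := by
  have hn : (0 : ℝ) ≤ n := n.cast_nonneg
  have hkl : ∀ t : ℝ, 0 ≤ Real.exp t * t - Real.exp t + 1 := fun t => by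
    have h := klFun_nonneg (Real.exp_pos t).le
    rw [klFun_apply, Real.log_exp] at h
    linarith
  rw [clampedLog]
  split_ifs with h0
  · simp [h0]
  · have hx' : 0 < x := lt_of_le_of_ne hx (Ne.symm h0)
    rcases le_total (Real.log x) n with h1 | h1
    · rw [min_eq_right h1]
      rcases le_total (-(n : ℝ)) (Real.log x) with h2 | h2
      · rw [max_eq_right h2]
        simpa [Real.exp_log hx'] using hkl (Real.log x)
      · rw [max_eq_left h2]
        have h3 : x ≤ Real.exp (-n) := (Real.log_le_iff_le_exp hx').1 h2
        nlinarith [hkl (-n)]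
    · rw [min_eq_left h1, max_eq_right (by linarith)]
      have h3 : Real.exp n ≤ x := (Real.le_log_iff_exp_le hx').1 h1
      nlinarith [hkl n]

theorem tendsto_clampedLog_young {x : ℝ} (hx : 0 ≤ x) :
    Tendsto (fun n : ℕ => x * clampedLog n x - Real.exp (clampedLog n x) + 1) atTop
      (𝓝 (klFun x)) := by
  by_cases h0 : x = 0
  · subst h0
    have h : Tendsto (fun n : ℕ => -Real.exp (-(n : ℝ)) + 1) atTop (𝓝 (-0 + 1)) :=
      ((Real.tendsto_exp_neg_atTop_nhds_zero.comp tendsto_natCast_atTop_atTop).neg).add_const 1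
    simpa [clampedLog, klFun_zero] using h
  · refine tendsto_const_nhds.congr' ?_
    filter_upwards [tendsto_natCast_atTop_atTop.eventually_ge_atTop |Real.log x|] with n hn
    have h1 := abs_le.1 hn
    rw [clampedLog, if_neg h0, min_eq_right h1.2, max_eq_right h1.1, klFun_apply,
      Real.exp_log (lt_of_le_of_ne hx (Ne.symm h0))]
    ring

section Variational

variable {X : Type*} [MeasurableSpace X]

theorem integral_sub_add_one {μ : Measure X} [IsProbabilityMeasure μ] {u v : X → ℝ}
    (hu : Integrable u μ) (hv : Integrable v μ) :
    ∫ x, (u x - v x + 1) ∂μ = ∫ x, u x ∂μ - ∫ x, v x ∂μ + 1 := by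
  rw [integral_add (f := fun x => u x - v x) (hu.sub hv) (integrable_const 1),
    integral_sub hu hv]
  simp

/-- A form of the Donsker-Varadhan formula, with bounded measurable functions. -/
theorem exists_measurable_lt_of_lt_klDiv (μ ν : Measure X) [IsProbabilityMeasure μ]
    [IsProbabilityMeasure ν] {a : ℝ} (ha : ENNReal.ofReal a < klDiv μ ν) :
    ∃ (h : X → ℝ) (n : ℝ), Measurable h ∧ (∀ x, |h x| ≤ n) ∧
      a < ∫ x, h x ∂μ - ∫ x, Real.exp (h x) ∂ν + 1 := by
  by_cases hac : μ ≪ ν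
  · rw [klDiv_eq_lintegral_klFun_of_ac hac] at ha
    set g : X → ℝ := fun x => (μ.rnDeriv ν x).toReal
    have hg : Measurable g := by fun_prop
    have hgi : Integrable g ν := Measure.integrable_toReal_rnDeriv
    have hφm : ∀ n : ℕ, Measurable fun x =>
        g x * clampedLog n (g x) - Real.exp (clampedLog n (g x)) + 1 := fun n => by
      have := (measurable_clampedLog n).comp hg
      exact ((hg.mul this).sub this.exp).add_const 1
    have hfatou := lintegral_liminf_le (u := atTop) (μ := ν) fun n => (hφm n).ennreal_ofReal
    have hlim : ∀ x, liminf (fun n : ℕ => ENNReal.ofReal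
        (g x * clampedLog n (g x) - Real.exp (clampedLog n (g x)) + 1)) atTop
        = ENNReal.ofReal (klFun (g x)) := fun x =>
      ((ENNReal.continuous_ofReal.tendsto _).comp
        (tendsto_clampedLog_young ENNReal.toReal_nonneg)).liminf_eq
    simp_rw [hlim] at hfatou
    obtain ⟨n, hn⟩ := (eventually_lt_of_lt_liminf (ha.trans_le hfatou)).exists
    have hc : Measurable fun x => clampedLog n (g x) := (measurable_clampedLog n).comp hg
    have hi1 : Integrable (fun x => g x * clampedLog n (g x)) ν :=
      hgi.mul_bdd (c := n) hc.aestronglyMeasurable (ae_of_all _ fun x => abs_clampedLog_le n (g x))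
    have hi2 : Integrable (fun x => Real.exp (clampedLog n (g x))) ν :=
      Integrable.of_bound hc.exp.aestronglyMeasurable (Real.exp n) (ae_of_all _ fun x => by
        rw [Real.norm_eq_abs, Real.abs_exp]
        exact Real.exp_le_exp.2 (abs_le.1 (abs_clampedLog_le n (g x))).2)
    have hi3 : Integrable (fun x =>
        g x * clampedLog n (g x) - Real.exp (clampedLog n (g x)) + 1) ν :=
      (hi1.sub hi2).add (integrable_const 1)
    rw [← ofReal_integral_eq_lintegral_ofReal hi3
      (ae_of_all _ fun x => clampedLog_young_nonneg n ENNReal.toReal_nonneg)] at hn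
    refine ⟨fun x => clampedLog n (g x), n, hc, fun x => abs_clampedLog_le n (g x), ?_⟩
    have h1 : ∫ x, g x * clampedLog n (g x) ∂ν = ∫ x, clampedLog n (g x) ∂μ :=
      integral_toReal_rnDeriv_mul hac
    rw [← h1, ← integral_sub_add_one hi1 hi2]
    exact (ENNReal.ofReal_lt_ofReal_iff'.1 hn).1
  · obtain ⟨A, hA, hνA, hμA⟩ : ∃ A, MeasurableSet A ∧ ν A = 0 ∧ μ A ≠ 0 := by
      by_contra! hcon
      exact hac (Measure.AbsolutelyContinuous.mk hcon)
    have hpos : 0 < μ.real A := ENNReal.toReal_pos hμA (measure_ne_top _ _)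
    set t : ℝ := (|a| + 1) / μ.real A
    have ht : 0 ≤ t := by positivity
    refine ⟨A.indicator fun _ => t, t, measurable_const.indicator hA, fun x => ?_, ?_⟩
    · by_cases hx : x ∈ A <;> simp [hx, abs_of_nonneg ht, ht]
    · have h1 : ∫ x, Real.exp (A.indicator (fun _ => t) x) ∂ν = 1 := by
        rw [integral_congr_ae (g := fun _ => 1)]
        · simp
        · filter_upwards [measure_eq_zero_iff_ae_notMem.1 hνA] with x hx
          simp [hx]
      rw [h1, integral_indicator_const _ hA, smul_eq_mul, mul_div_cancel₀ _ hpos.ne']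
      linarith [le_abs_self a]

theorem ofReal_integral_sub_le_klDiv (μ ν : Measure X) [IsProbabilityMeasure μ]
    [IsProbabilityMeasure ν] {f : X → ℝ} (hf : Integrable f μ)
    (hexp : Integrable (fun x => Real.exp (f x)) ν) :
    ENNReal.ofReal (∫ x, f x ∂μ - ∫ x, Real.exp (f x) ∂ν + 1) ≤ klDiv μ ν := by
  by_cases htop : klDiv μ ν = ∞
  · simp [htop]
  obtain ⟨hac, hint⟩ := klDiv_ne_top_iff.1 htop
  rw [← ENNReal.ofReal_toReal htop, toReal_klDiv_eq_integral_klFun hac]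
  refine ENNReal.ofReal_le_ofReal ?_
  have hi1 : Integrable (fun x => (μ.rnDeriv ν x).toReal * f x) ν :=
    (integrable_toReal_rnDeriv_mul_iff hac).2 hf
  have h1 : ∫ x, (μ.rnDeriv ν x).toReal * f x ∂ν = ∫ x, f x ∂μ :=
    integral_toReal_rnDeriv_mul hac
  calc ∫ x, f x ∂μ - ∫ x, Real.exp (f x) ∂ν + 1
      = ∫ x, ((μ.rnDeriv ν x).toReal * f x - Real.exp (f x) + 1) ∂ν := by
        rw [integral_sub_add_one hi1 hexp, h1]
    _ ≤ _ := integral_mono ((hi1.sub hexp).add (integrable_const 1))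
        ((integrable_klFun_rnDeriv_iff hac).2 hint)
        fun x => mul_sub_exp_add_one_le_klFun ENNReal.toReal_nonneg _

end Variational

section Continuous

variable {X : Type*} [MetricSpace X] [CompactSpace X] [MeasurableSpace X] [BorelSpace X]

/-- A form of the Donsker-Varadhan formula, with continuous functions. -/
theorem exists_continuousMap_lt_of_lt_klDiv (μ ν : Measure X) [IsProbabilityMeasure μ]
    [IsProbabilityMeasure ν] {a : ℝ} (ha : ENNReal.ofReal a < klDiv μ ν) :
    ∃ f : C(X, ℝ), a < ∫ x, f x ∂μ - ∫ x, Real.exp (f x) ∂ν + 1 := by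
  obtain ⟨h, n, hm, hn, hlt⟩ := exists_measurable_lt_of_lt_klDiv μ ν ha
  set δ := ∫ x, h x ∂μ - ∫ x, Real.exp (h x) ∂ν + 1 - a
  have hδ : 0 < δ := sub_pos.2 hlt
  have hhi : ∀ (κ : Measure X) [IsFiniteMeasure κ], Integrable h κ := fun κ _ =>
    Integrable.of_bound hm.aestronglyMeasurable n (ae_of_all _ hn)
  have hei : Integrable (fun x => Real.exp (h x)) ν :=
    Integrable.of_bound hm.exp.aestronglyMeasurable (Real.exp n) (ae_of_all _ fun x => by
      rw [Real.norm_eq_abs, Real.abs_exp]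
      exact Real.exp_le_exp.2 (abs_le.1 (hn x)).2)
  obtain ⟨k, hk, -⟩ := (hhi (μ + ν)).exists_boundedContinuous_integral_sub_le
    (ε := δ / (2 * (1 + Real.exp n))) (by positivity)
  let f : C(X, ℝ) := ⟨fun x => max (-n) (min n (k x)), by fun_prop⟩
  have hfh : ∀ x, |h x - f x| ≤ |h x - k x| := fun x => by
    have h1 := abs_le.1 (hn x)
    change |h x - max (-n) (min n (k x))| ≤ _
    rcases le_total n (k x) with h2 | h2
    · rw [min_eq_left h2, max_eq_right (by linarith), abs_le]
      constructor <;> cases abs_cases (h x - k x) <;> linarith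
    · rw [min_eq_right h2]
      rcases le_total (-n) (k x) with h3 | h3
      · rw [max_eq_right h3]
      · rw [max_eq_left h3, abs_le]
        constructor <;> cases abs_cases (h x - k x) <;> linarith
  have hfn : ∀ x, f x ≤ n := fun x =>
    max_le (by linarith [(abs_nonneg (h x)).trans (hn x)]) (min_le_left _ _)
  have hdi : ∀ (κ : Measure X) [IsFiniteMeasure κ], Integrable (fun x => |h x - f x|) κ :=
    fun κ _ => ((hhi κ).sub (integrable_continuousMap κ f)).abs
  have hfe : Integrable (fun x => Real.exp (f x)) ν :=
    integrable_continuousMap ν ⟨fun x => Real.exp (f x), by fun_prop⟩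
  have hsum : ∫ x, |h x - f x| ∂μ + ∫ x, |h x - f x| ∂ν ≤ δ / (2 * (1 + Real.exp n)) := by
    rw [← integral_add_measure (hdi μ) (hdi ν)]
    refine (integral_mono (hdi _) ?_ hfh).trans hk
    exact ((hhi _).sub (k.integrable _)).abs
  have h1 : ∫ x, h x ∂μ ≤ ∫ x, f x ∂μ + ∫ x, |h x - f x| ∂μ := by
    rw [← integral_add (integrable_continuousMap μ f) (hdi μ)]
    refine integral_mono (hhi μ) ((integrable_continuousMap μ f).add (hdi μ)) fun x => ?_
    change h x ≤ f x + |h x - f x|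
    linarith [le_abs_self (h x - f x)]
  have h2 : ∫ x, Real.exp (f x) ∂ν
      ≤ ∫ x, Real.exp (h x) ∂ν + Real.exp n * ∫ x, |h x - f x| ∂ν := by
    rw [← integral_const_mul, ← integral_add hei ((hdi ν).const_mul _)]
    refine integral_mono hfe (hei.add ((hdi ν).const_mul _)) fun x => ?_
    change Real.exp (f x) ≤ Real.exp (h x) + Real.exp n * |h x - f x|
    have h3 : Real.exp (f x) * (h x - f x + 1) ≤ Real.exp (h x) := by
      calc _ ≤ Real.exp (f x) * Real.exp (h x - f x) := by
            gcongr
            exact Real.add_one_le_exp _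
        _ = _ := by rw [← Real.exp_add]; congr 1; ring
    have h4 : Real.exp (f x) * -(h x - f x) ≤ Real.exp n * |h x - f x| := by
      calc _ ≤ Real.exp (f x) * |h x - f x| := by
            gcongr
            exact neg_le_abs _
        _ ≤ _ := by
            gcongr
            exact hfn x
    linarith
  refine ⟨f, ?_⟩
  have h5 : (0 : ℝ) ≤ ∫ x, |h x - f x| ∂μ := integral_nonneg fun _ => abs_nonneg _
  have h6 : (0 : ℝ) ≤ ∫ x, |h x - f x| ∂ν := integral_nonneg fun _ => abs_nonneg _
  have h7 : (1 + Real.exp n) * (∫ x, |h x - f x| ∂μ + ∫ x, |h x - f x| ∂ν) ≤ δ / 2 := by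
    rw [le_div_iff₀ (by positivity)] at hsum
    linarith
  have h8 := mul_nonneg (Real.exp_pos n).le h5
  have h9 : δ = ∫ x, h x ∂μ - ∫ x, Real.exp (h x) ∂ν + 1 - a := rfl
  linarith

theorem exists_continuousMap_lt_of_lt_relEntropy (μ₀ : Measure X) [IsProbabilityMeasure μ₀]
    (m : ProbabilityMeasure X) {a : ℝ} (ha : (a : EReal) < relEntropy μ₀ m) :
    ∃ f : C(X, ℝ), a < ∫ x, f x ∂(m : Measure X) - ∫ x, Real.exp (f x) ∂μ₀ + 1 := by
  rcases lt_or_ge a 0 with h | h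
  · exact ⟨0, by simpa using h⟩
  · refine exists_continuousMap_lt_of_lt_klDiv _ _ (EReal.coe_ennreal_lt_coe_ennreal_iff.1 ?_)
    rwa [EReal.coe_ennreal_ofReal, max_eq_left h]

theorem integral_sub_le_relEntropy (μ₀ : Measure X) [IsProbabilityMeasure μ₀]
    (m : ProbabilityMeasure X) (f : C(X, ℝ)) :
    ((∫ x, f x ∂(m : Measure X) - ∫ x, Real.exp (f x) ∂μ₀ + 1 : ℝ) : EReal)
      ≤ relEntropy μ₀ m := by
  have h := EReal.coe_ennreal_le_coe_ennreal_iff.2 (ofReal_integral_sub_le_klDiv (m : Measure X) μ₀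
    (integrable_continuousMap _ f)
    (integrable_continuousMap μ₀ ⟨fun x => Real.exp (f x), by fun_prop⟩))
  rw [EReal.coe_ennreal_ofReal] at h
  exact (EReal.coe_le_coe_iff.2 (le_max_left _ _)).trans h

theorem isOpen_setOf_lt_integral_sub (μ₀ : Measure X) (f : C(X, ℝ)) (a : ℝ) :
    IsOpen {ν : ProbabilityMeasure X |
      a < ∫ x, f x ∂(ν : Measure X) - ∫ x, Real.exp (f x) ∂μ₀ + 1} :=
  isOpen_lt continuous_const
    (((ProbabilityMeasure.continuous_integral_continuousMap f).sub continuous_const).add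
      continuous_const)

theorem lowerSemicontinuous_relEntropy (μ₀ : Measure X) [IsProbabilityMeasure μ₀] :
    LowerSemicontinuous (relEntropy μ₀ : ProbabilityMeasure X → EReal) := by
  intro m y hy
  obtain ⟨a, hya, ha⟩ := EReal.exists_between_coe_real hy
  obtain ⟨f, hf⟩ := exists_continuousMap_lt_of_lt_relEntropy μ₀ m ha
  filter_upwards [(isOpen_setOf_lt_integral_sub μ₀ f a).mem_nhds hf] with ν hν
  exact hya.trans ((EReal.coe_lt_coe_iff.2 hν).trans_le (integral_sub_le_relEntropy μ₀ ν f))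

/-- The local upper bound in Sanov's theorem. -/
theorem exists_pi_empiricalMeasure_mem_le (μ₀ : Measure X) [IsProbabilityMeasure μ₀]
    (m : ProbabilityMeasure X) {a : ℝ} (ha : (a : EReal) < relEntropy μ₀ m) :
    ∃ U : Set (ProbabilityMeasure X), IsOpen U ∧ m ∈ U ∧ ∀ N : ℕ+,
      (Measure.pi fun _ : Fin N => μ₀) (empiricalMeasure ⁻¹' U)
        ≤ ENNReal.ofReal (Real.exp (-(a * N))) := by
  obtain ⟨f, hf⟩ := exists_continuousMap_lt_of_lt_relEntropy μ₀ m ha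
  refine ⟨_, isOpen_setOf_lt_integral_sub μ₀ f a, hf, fun N => ?_⟩
  set L := ∫ x, Real.exp (f x) ∂μ₀
  have hN : (0 : ℝ) < N := by exact_mod_cast N.pos
  let F : X → ℝ≥0∞ := fun x => ENNReal.ofReal (Real.exp (f x - (a + L - 1)))
  have hF : Measurable F := (f.continuous.measurable.sub_const _).exp.ennreal_ofReal
  have hFint : ∫⁻ x, F x ∂μ₀ ≤ ENNReal.ofReal (Real.exp (-a)) := by
    have hint : Integrable (fun x => Real.exp (f x - (a + L - 1))) μ₀ :=
      integrable_continuousMap μ₀ ⟨fun x => Real.exp (f x - (a + L - 1)), by fun_prop⟩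
    rw [← ofReal_integral_eq_lintegral_ofReal hint (ae_of_all _ fun x => (Real.exp_pos _).le)]
    refine ENNReal.ofReal_le_ofReal ?_
    simp_rw [Real.exp_sub (f _)]
    rw [integral_div, div_le_iff₀ (Real.exp_pos _), ← Real.exp_add]
    have h := Real.add_one_le_exp (L - 1)
    rw [show -a + (a + L - 1) = L - 1 by ring]
    change L ≤ _
    linarith
  have hprod := lintegral_pi_prod μ₀ (N := N) (f := fun _ => F) fun _ => hF
  calc _ ≤ (Measure.pi fun _ : Fin N => μ₀) {x | 1 ≤ ∏ i, F (x i)} := by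
        refine measure_mono fun x hx => ?_
        change a < ∫ y, f y ∂(empiricalMeasure x : Measure X) - L + 1 at hx
        rw [integral_empiricalMeasure] at hx
        have h1 : (a + L - 1) * N < ∑ i, f (x i) := by
          rw [← lt_div_iff₀ hN]
          linarith
        change 1 ≤ ∏ i, ENNReal.ofReal (Real.exp (f (x i) - (a + L - 1)))
        rw [← ENNReal.ofReal_prod_of_nonneg fun i _ => (Real.exp_pos _).le, ← Real.exp_sum,
          ENNReal.one_le_ofReal, Real.one_le_exp_iff, Finset.sum_sub_distrib]
        simp only [Finset.sum_const, Finset.card_univ, Fintype.card_fin, nsmul_eq_mul]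
        linarith
    _ ≤ ∫⁻ x, ∏ i, F (x i) ∂(Measure.pi fun _ : Fin N => μ₀) := by
        have h := mul_meas_ge_le_lintegral (μ := Measure.pi fun _ : Fin N => μ₀)
          (f := fun x => ∏ i, F (x i))
          (Finset.measurable_prod _ fun i _ => hF.comp (measurable_pi_apply i)) 1
        rwa [one_mul] at h
    _ = (∫⁻ x, F x ∂μ₀) ^ (N : ℕ) := by rw [hprod]; simp
    _ ≤ ENNReal.ofReal (Real.exp (-a)) ^ (N : ℕ) := by gcongr
    _ = _ := by
        rw [← ENNReal.ofReal_pow (Real.exp_pos _).le, ← Real.exp_nat_mul]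
        congr 2
        ring

end Continuous

section Gibbs

variable {X : Type*} [MeasurableSpace X]

theorem empiricalLaw_apply (μ₀ : Measure X) {N : ℕ} [NeZero N] (H : (Fin N → X) → ℝ) (b : ℝ)
    {U : Set (ProbabilityMeasure X)} (hU : MeasurableSet U) :
    empiricalLaw μ₀ H b U = ∫⁻ x in empiricalMeasure ⁻¹' U,
      ENNReal.ofReal (Real.exp (-(b * H x))) ∂(Measure.pi fun _ : Fin N => μ₀) := by
  rw [empiricalLaw, Measure.map_apply measurable_empiricalMeasure hU, gibbsMeasure,
    withDensity_apply _ (measurable_empiricalMeasure hU)]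

theorem empiricalLaw_le (μ₀ : Measure X) {N : ℕ} [NeZero N] (H : (Fin N → X) → ℝ) (b : ℝ)
    {U : Set (ProbabilityMeasure X)} (hU : MeasurableSet U) {K : ℝ}
    (hK : ∀ x, empiricalMeasure x ∈ U → -(b * H x) ≤ K) :
    empiricalLaw μ₀ H b U ≤ ENNReal.ofReal (Real.exp K) *
      (Measure.pi fun _ : Fin N => μ₀) (empiricalMeasure ⁻¹' U) := by
  rw [empiricalLaw_apply μ₀ H b hU, ← setLIntegral_const]
  exact setLIntegral_mono measurable_const fun x hx =>
    ENNReal.ofReal_le_ofReal (Real.exp_le_exp.2 (hK x hx))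

theorem le_empiricalLaw (μ₀ : Measure X) {N : ℕ} [NeZero N] (H : (Fin N → X) → ℝ) (b : ℝ)
    {U : Set (ProbabilityMeasure X)} (hU : MeasurableSet U) {K : ℝ}
    (hK : ∀ x, empiricalMeasure x ∈ U → K ≤ -(b * H x)) :
    ENNReal.ofReal (Real.exp K) * (Measure.pi fun _ : Fin N => μ₀) (empiricalMeasure ⁻¹' U)
      ≤ empiricalLaw μ₀ H b U := by
  rw [empiricalLaw_apply μ₀ H b hU, ← setLIntegral_const]
  exact setLIntegral_mono' (measurable_empiricalMeasure hU) fun x hx =>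
    ENNReal.ofReal_le_ofReal (Real.exp_le_exp.2 (hK x hx))

end Gibbs

section Energy

variable {X : Type*} [MetricSpace X] [CompactSpace X] [MeasurableSpace X] [BorelSpace X]
  {H : (N : ℕ+) → (Fin N → X) → ℝ}

/-- A symmetric equicontinuous family of energies has small oscillation on the set of configurations
whose empirical measure is near a given measure. -/
theorem exists_nhds_oscillation_le
    (hsymm : ∀ (N : ℕ+) (σ : Equiv.Perm (Fin N)) (x : Fin N → X), H N (x ∘ σ) = H N x)
    (hequi : ∀ ε : ℝ, 0 < ε → ∃ δ : ℝ, 0 < δ ∧ ∀ (N : ℕ+) (x y : Fin N → X),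
      (1 / (N : ℝ)) * ∑ i, dist (x i) (y i) ≤ δ → |H N x - H N y| / (N : ℝ) ≤ ε)
    (m : ProbabilityMeasure X) {ε : ℝ} (hε : 0 < ε) :
    ∃ V ∈ 𝓝 m, ∀ (N : ℕ+) (x y : Fin N → X), empiricalMeasure x ∈ V → empiricalMeasure y ∈ V →
      |H N x - H N y| ≤ ε * N := by
  obtain ⟨δ, hδ, h⟩ := hequi ε hε
  have hD : 0 < 1 + Metric.diam (Set.univ : Set X) := by
    have : 0 ≤ Metric.diam (Set.univ : Set X) := Metric.diam_nonneg
    positivity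
  set η := δ / (1 + Metric.diam (Set.univ : Set X))
  have hη : 0 < η := by positivity
  refine ⟨_, eventually_levyProkhorovEDist_lt m (ε := η / 2) (by positivity), ?_⟩
  intro N x y hx hy
  have hxy : levyProkhorovEDist (empiricalMeasure x : Measure X) (empiricalMeasure y)
      < ENNReal.ofReal η := by
    refine (levyProkhorovEDist_triangle _ (m : Measure X) _).trans_lt ?_
    rw [← add_halves η, ENNReal.ofReal_add (by positivity) (by positivity)]
    refine ENNReal.add_lt_add hx ?_
    rw [levyProkhorovEDist_comm]
    exact hy
  obtain ⟨σ, hσ⟩ := exists_perm_sum_dist_le x y hη hxy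
  rw [div_mul_cancel₀ _ hD.ne'] at hσ
  have h1 := h N x (y ∘ σ) hσ
  rwa [hsymm, div_le_iff₀ (by exact_mod_cast N.pos)] at h1

variable {μ₀ : Measure X} [IsProbabilityMeasure μ₀] {b : ℕ+ → ℝ} {E : ProbabilityMeasure X → EReal}

theorem eventually_lt_energy (hsupp : μ₀.support = Set.univ)
    (hosc : ∀ (m : ProbabilityMeasure X) (ε : ℝ), 0 < ε → ∃ V ∈ 𝓝 m,
      ∀ (N : ℕ+) (x y : Fin N → X), empiricalMeasure x ∈ V → empiricalMeasure y ∈ V →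
      |H N x - H N y| ≤ ε * N)
    (hbpos : ∀ N, 0 < b N) (hb : Tendsto b atTop atTop)
    (hLDP : SatisfiesLDP atTop
      (fun N : ℕ+ => empiricalLaw μ₀ (H N) (b N)) (fun N => b N * (N : ℝ)) E)
    (m : ProbabilityMeasure X) {s : ℝ} (hs : (s : EReal) < E m) {ε : ℝ} (hε : 0 < ε) :
    ∃ U : Set (ProbabilityMeasure X), IsOpen U ∧ m ∈ U ∧ ∀ᶠ N : ℕ+ in atTop,
      ∀ x : Fin N → X, empiricalMeasure x ∈ U → (s - ε) * N ≤ H N x := by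
  have hpos : ∀ N : ℕ+, (0 : ℝ) < N := fun N => by exact_mod_cast N.pos
  obtain ⟨V, hV, hVosc⟩ := hosc m (ε / 2) (by positivity)
  obtain ⟨s', hss', hs'⟩ := EReal.exists_between_coe_real hs
  obtain ⟨F, hF, hFc, hFV⟩ := exists_mem_nhds_isClosed_subset
    (inter_mem hV (hLDP.lowerSemicontinuous m s' hs'))
  have hinf : (s : EReal) < ⨅ ν ∈ F, E ν :=
    hss'.trans_le (le_iInf₂ fun ν hν => le_of_lt (hFV hν).2)
  have hmU : m ∈ interior F := mem_interior_iff_mem_nhds.2 hF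
  obtain ⟨c, hc⟩ := exists_exp_le_pi_empiricalMeasure_mem μ₀ hsupp m isOpen_interior hmU
  refine ⟨interior F, isOpen_interior, hmU, ?_⟩
  filter_upwards [hc, (hb.const_mul_atTop (half_pos hε)).eventually_ge_atTop c,
    hLDP.eventually_le (Eventually.of_forall fun N => mul_pos (hbpos N) (hpos N)) hFc hinf]
    with N h1 h2 h3 x hx
  have h4 := le_empiricalLaw μ₀ (H N) (b N) (U := interior F) isOpen_interior.measurableSet
    (K := -(b N * (H N x + ε / 2 * N))) fun y hy => by
      have h5 := abs_le.1 (hVosc N x y (hFV (interior_subset hx)).1 (hFV (interior_subset hy)).1)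
      have h6 : H N y ≤ H N x + ε / 2 * N := by linarith
      have := mul_le_mul_of_nonneg_left h6 (hbpos N).le
      linarith
  have h5 : ENNReal.ofReal (Real.exp (-(b N * (H N x + ε / 2 * N)))) *
      ENNReal.ofReal (Real.exp (-(c * N))) ≤ ENNReal.ofReal (Real.exp (-(s * (b N * N)))) :=
    (mul_le_mul_right h1 _).trans (h4.trans ((measure_mono interior_subset).trans h3))
  rw [← ENNReal.ofReal_mul (Real.exp_pos _).le, ← Real.exp_add,
    ENNReal.ofReal_le_ofReal_iff (Real.exp_pos _).le, Real.exp_le_exp] at h5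
  have h6 := mul_le_mul_of_nonneg_right h2 (hpos N).le
  refine le_of_mul_le_mul_left ?_ (hbpos N)
  nlinarith

theorem eventually_energy_lt
    (hosc : ∀ (m : ProbabilityMeasure X) (ε : ℝ), 0 < ε → ∃ V ∈ 𝓝 m,
      ∀ (N : ℕ+) (x y : Fin N → X), empiricalMeasure x ∈ V → empiricalMeasure y ∈ V →
      |H N x - H N y| ≤ ε * N)
    (hbpos : ∀ N, 0 < b N)
    (hLDP : SatisfiesLDP atTop
      (fun N : ℕ+ => empiricalLaw μ₀ (H N) (b N)) (fun N => b N * (N : ℝ)) E)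
    (m : ProbabilityMeasure X) {s : ℝ} (hs : E m < s) {ε : ℝ} (hε : 0 < ε) :
    ∃ U : Set (ProbabilityMeasure X), IsOpen U ∧ m ∈ U ∧ ∀ᶠ N : ℕ+ in atTop,
      ∀ x : Fin N → X, empiricalMeasure x ∈ U → H N x ≤ (s + ε) * N := by
  have hpos : ∀ N : ℕ+, (0 : ℝ) < N := fun N => by exact_mod_cast N.pos
  obtain ⟨V, hV, hVosc⟩ := hosc m ε hε
  have hmU : m ∈ interior V := mem_interior_iff_mem_nhds.2 hV
  refine ⟨interior V, isOpen_interior, hmU, ?_⟩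
  filter_upwards [hLDP.eventually_ge (Eventually.of_forall fun N => mul_pos (hbpos N) (hpos N))
    isOpen_interior hmU hs] with N h1 x hx
  have h2 := empiricalLaw_le μ₀ (H N) (b N) (U := interior V) isOpen_interior.measurableSet
    (K := -(b N * (H N x - ε * N))) fun y hy => by
      have h5 := abs_le.1 (hVosc N x y (interior_subset hx) (interior_subset hy))
      have h6 : H N x - ε * N ≤ H N y := by linarith
      have := mul_le_mul_of_nonneg_left h6 (hbpos N).le
      linarith
  have h3 := h1.trans (h2.trans (mul_le_of_le_one_right' prob_le_one))
  rw [ENNReal.ofReal_le_ofReal_iff (Real.exp_pos _).le, Real.exp_le_exp] at h3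
  refine le_of_mul_le_mul_left ?_ (hbpos N)
  linarith

/-- The rate function of the zero temperature large deviation principle is the limit of the energy
per particle: it is real-valued and continuous, and the convergence is locally uniform. -/
theorem exists_macroscopic_energy (hsupp : μ₀.support = Set.univ)
    (hbdd : ∃ C : ℝ, ∀ (N : ℕ+) (x : Fin N → X), |H N x / (N : ℝ)| ≤ C)
    (hosc : ∀ (m : ProbabilityMeasure X) (ε : ℝ), 0 < ε → ∃ V ∈ 𝓝 m,
      ∀ (N : ℕ+) (x y : Fin N → X), empiricalMeasure x ∈ V → empiricalMeasure y ∈ V →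
      |H N x - H N y| ≤ ε * N)
    (hbpos : ∀ N, 0 < b N) (hb : Tendsto b atTop atTop)
    (hLDP : SatisfiesLDP atTop
      (fun N : ℕ+ => empiricalLaw μ₀ (H N) (b N)) (fun N => b N * (N : ℝ)) E) :
    ∃ e : ProbabilityMeasure X → ℝ, (∀ m, E m = e m) ∧ Continuous e ∧
      ∀ m (ε : ℝ), 0 < ε → ∃ U : Set (ProbabilityMeasure X), IsOpen U ∧ m ∈ U ∧
        ∀ᶠ N : ℕ+ in atTop, ∀ x : Fin N → X, empiricalMeasure x ∈ U →
          |H N x - e m * N| ≤ ε * N := by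
  have hpos : ∀ N : ℕ+, (0 : ℝ) < N := fun N => by exact_mod_cast N.pos
  obtain ⟨C, hC⟩ := hbdd
  have htop : ∀ m, E m ≠ ⊤ := by
    intro m hm
    obtain ⟨U, hU, hmU, h⟩ := eventually_lt_energy hsupp hosc hbpos hb hLDP m
      (s := C + 2) (by rw [hm]; exact EReal.coe_lt_top _) one_pos
    obtain ⟨N, hN, x, hx⟩ := (h.and (exists_empiricalMeasure_mem m hU hmU)).exists
    have h1 := hN x hx
    have h2 := (abs_le.1 (hC N x)).2
    rw [div_le_iff₀ (hpos N)] at h2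
    nlinarith [hpos N]
  have hE : ∀ m, E m = (E m).toReal := fun m => (EReal.coe_toReal (htop m) (hLDP.ne_bot m)).symm
  have hloc : ∀ m (ε : ℝ), 0 < ε → ∃ U : Set (ProbabilityMeasure X), IsOpen U ∧ m ∈ U ∧
        ∀ᶠ N : ℕ+ in atTop, ∀ x : Fin N → X, empiricalMeasure x ∈ U →
          |H N x - (E m).toReal * N| ≤ ε * N := by
    intro m ε hε
    obtain ⟨U, hU, hmU, h⟩ := eventually_lt_energy hsupp hosc hbpos hb hLDP m
      (s := (E m).toReal - ε / 2) (by
        conv_rhs => rw [hE m]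
        exact EReal.coe_lt_coe_iff.2 (by linarith)) (half_pos hε)
    obtain ⟨U', hU', hmU', h'⟩ := eventually_energy_lt hosc hbpos hLDP m
      (s := (E m).toReal + ε / 2) (by
        conv_lhs => rw [hE m]
        exact EReal.coe_lt_coe_iff.2 (by linarith)) (half_pos hε)
    refine ⟨U ∩ U', hU.inter hU', ⟨hmU, hmU'⟩, ?_⟩
    filter_upwards [h, h'] with N h1 h2 x hx
    rw [abs_le]
    constructor
    · linarith [h1 x hx.1]
    · linarith [h2 x hx.2]
  refine ⟨fun m => (E m).toReal, hE, continuous_iff_continuousAt.2 fun m => ?_, hloc⟩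
  rw [ContinuousAt, Metric.tendsto_nhds]
  intro ε hε
  obtain ⟨U, hU, hmU, h⟩ := hloc m (ε / 3) (by positivity)
  filter_upwards [hU.mem_nhds hmU] with ν hν
  obtain ⟨U', hU', hνU', h'⟩ := hloc ν (ε / 3) (by positivity)
  obtain ⟨N, ⟨hN, hN'⟩, x, hx⟩ := ((h.and h').and
    (exists_empiricalMeasure_mem ν (hU.inter hU') ⟨hν, hνU'⟩)).exists
  have h1 := abs_le.1 (hN x hx.1)
  have h2 := abs_le.1 (hN' x hx.2)
  have h3 : |(E ν).toReal - (E m).toReal| ≤ 2 * (ε / 3) := by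
    rw [abs_le]
    constructor
    · refine le_of_mul_le_mul_right ?_ (hpos N)
      linarith
    · refine le_of_mul_le_mul_right ?_ (hpos N)
      linarith
  rw [Real.dist_eq]
  linarith

end Energy

section Rate

variable {D : EReal} {c t a : ℝ}

theorem coe_lt_coe_add_div_iff (hc : 0 < c) (hD : D ≠ ⊥) :
    (a : EReal) < ((t / c : ℝ) : EReal) + D / (c : EReal) ↔ ((c * a - t : ℝ) : EReal) < D := by
  induction D with
  | bot => exact absurd rfl hD
  | top =>
    rw [EReal.top_div_of_pos_ne_top (by exact_mod_cast hc) (EReal.coe_ne_top c),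
      EReal.coe_add_top]
    exact iff_of_true (EReal.coe_lt_top _) (EReal.coe_lt_top _)
  | coe d =>
    rw [← EReal.coe_div, ← EReal.coe_add, EReal.coe_lt_coe_iff, EReal.coe_lt_coe_iff, ← add_div,
      lt_div_iff₀ hc]
    constructor <;> intro h <;> linarith

theorem coe_add_div_lt_coe_iff (hc : 0 < c) (hD : D ≠ ⊥) :
    ((t / c : ℝ) : EReal) + D / (c : EReal) < a ↔ D < ((c * a - t : ℝ) : EReal) := by
  induction D with
  | bot => exact absurd rfl hD
  | top =>
    rw [EReal.top_div_of_pos_ne_top (by exact_mod_cast hc) (EReal.coe_ne_top c),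
      EReal.coe_add_top]
    simp
  | coe d =>
    rw [← EReal.coe_div, ← EReal.coe_add, EReal.coe_lt_coe_iff, EReal.coe_lt_coe_iff, ← add_div,
      div_lt_iff₀ hc]
    constructor <;> intro h <;> linarith

theorem relEntropy_nonneg {X : Type*} [MeasurableSpace X] (μ₀ : Measure X)
    (m : ProbabilityMeasure X) : 0 ≤ relEntropy μ₀ m :=
  EReal.coe_ennreal_nonneg _

theorem relEntropy_ne_bot {X : Type*} [MeasurableSpace X] (μ₀ : Measure X)
    (m : ProbabilityMeasure X) : relEntropy μ₀ m ≠ ⊥ :=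
  EReal.coe_ennreal_ne_bot _

end Rate

section Main

variable {X : Type*} [MetricSpace X] [CompactSpace X] [MeasurableSpace X] [BorelSpace X]
  {H : (N : ℕ+) → (Fin N → X) → ℝ} {μ₀ : Measure X} [IsProbabilityMeasure μ₀]

/-- If the energy per particle converges locally uniformly to a continuous function `e` of the
empirical measure, then the Gibbs measures at inverse temperature `β` satisfy a large deviation
principle whose rate function is the free energy. -/
theorem satisfiesLDP_empiricalLaw {e : ProbabilityMeasure X → ℝ} (he : Continuous e)
    (hloc : ∀ m (ε : ℝ), 0 < ε → ∃ U : Set (ProbabilityMeasure X), IsOpen U ∧ m ∈ U ∧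
        ∀ᶠ N : ℕ+ in atTop, ∀ x : Fin N → X, empiricalMeasure x ∈ U →
          |H N x - e m * N| ≤ ε * N) (β : ℝ) {c : ℝ} (hc : 0 < c) :
    SatisfiesLDP atTop (fun N : ℕ+ => empiricalLaw μ₀ (H N) β) (fun N => c * (N : ℝ))
      (fun μ => ((β * e μ / c : ℝ) : EReal) + relEntropy μ₀ μ / (c : EReal)) := by
  have hpos : ∀ N : ℕ+, (0 : ℝ) < N := fun N => by exact_mod_cast N.pos
  have hloc' : ∀ m (ε : ℝ), 0 < ε → ∃ U : Set (ProbabilityMeasure X), IsOpen U ∧ m ∈ U ∧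
      ∀ᶠ N : ℕ+ in atTop, ∀ x : Fin N → X, empiricalMeasure x ∈ U →
        |β * H N x - β * e m * N| ≤ ε * N := by
    intro m ε hε
    obtain ⟨U, hU, hmU, h⟩ := hloc m (ε / (|β| + 1)) (by positivity)
    refine ⟨U, hU, hmU, h.mono fun N hN x hx => ?_⟩
    calc |β * H N x - β * e m * N| = |β| * |H N x - e m * N| := by rw [← abs_mul]; ring_nf
      _ ≤ (|β| + 1) * (ε / (|β| + 1) * N) := by
          gcongr
          · linarith
          · exact hN x hx
      _ = ε * N := by field_simp
  refine SatisfiesLDP.of_local ?_ ?_ ?_ ?_ ?_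
  · exact (tendsto_natCast_atTop_atTop.comp tendsto_PNat_val_atTop_atTop).const_mul_atTop hc
  · intro m h
    have h1 : (((β * e m - 1) / c : ℝ) : EReal)
        < ((β * e m / c : ℝ) : EReal) + relEntropy μ₀ m / (c : EReal) := by
      rw [coe_lt_coe_add_div_iff hc (relEntropy_ne_bot μ₀ m), mul_div_cancel₀ _ hc.ne']
      refine lt_of_lt_of_le ?_ (relEntropy_nonneg μ₀ m)
      exact_mod_cast (by linarith : β * e m - 1 - β * e m < 0)
    rw [h] at h1
    exact not_lt_bot h1
  · intro m y hy
    obtain ⟨a, hya, ha⟩ := EReal.exists_between_coe_real hy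
    rw [coe_lt_coe_add_div_iff hc (relEntropy_ne_bot μ₀ m)] at ha
    obtain ⟨d, had, hd⟩ := EReal.exists_between_coe_real ha
    have hcont : Continuous fun ν => c * a - β * e ν :=
      continuous_const.sub (continuous_const.mul he)
    filter_upwards [lowerSemicontinuous_relEntropy μ₀ m d hd,
      hcont.continuousAt.eventually (gt_mem_nhds (EReal.coe_lt_coe_iff.1 had))] with ν h1 h2
    refine hya.trans ?_
    rw [coe_lt_coe_add_div_iff hc (relEntropy_ne_bot μ₀ ν)]
    exact (EReal.coe_lt_coe_iff.2 h2).trans h1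
  · intro m a ha
    rw [coe_lt_coe_add_div_iff hc (relEntropy_ne_bot μ₀ m)] at ha
    obtain ⟨d, had, hd⟩ := EReal.exists_between_coe_real ha
    obtain ⟨U, hU, hmU, h⟩ := hloc' m (d - (c * a - β * e m))
      (sub_pos.2 (EReal.coe_lt_coe_iff.1 had))
    obtain ⟨V, hV, hmV, h'⟩ := exists_pi_empiricalMeasure_mem_le μ₀ m hd
    refine ⟨U ∩ V, hU.inter hV, ⟨hmU, hmV⟩, h.mono fun N hN => ?_⟩
    refine (empiricalLaw_le μ₀ (H N) β (hU.inter hV).measurableSet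
      (K := (d - c * a) * N) fun x hx => ?_).trans ?_
    · linarith [(abs_le.1 (hN x hx.1)).1]
    · calc _ ≤ ENNReal.ofReal (Real.exp ((d - c * a) * N)) *
            ENNReal.ofReal (Real.exp (-(d * N))) := by
            gcongr
            exact (measure_mono fun x hx => hx.2).trans (h' N)
        _ = _ := by
            rw [← ENNReal.ofReal_mul (Real.exp_pos _).le, ← Real.exp_add]
            congr 2
            ring
  · intro m a ha V hV hmV
    rw [coe_add_div_lt_coe_iff hc (relEntropy_ne_bot μ₀ m)] at ha
    obtain ⟨d, hd, hda⟩ := EReal.exists_between_coe_real ha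
    obtain ⟨U, hU, hmU, h⟩ := hloc' m (c * a - β * e m - d)
      (sub_pos.2 (EReal.coe_lt_coe_iff.1 hda))
    have hd' : InformationTheory.klDiv (m : Measure X) μ₀ < ENNReal.ofReal d := by
      rw [← EReal.coe_ennreal_lt_coe_ennreal_iff, EReal.coe_ennreal_ofReal]
      exact hd.trans_le (EReal.coe_le_coe_iff.2 (le_max_left _ _))
    filter_upwards [h, eventually_exp_le_pi_empiricalMeasure_mem μ₀ m (hU.inter hV) ⟨hmU, hmV⟩ hd']
      with N hN hN'
    refine le_trans ?_ (measure_mono (Set.inter_subset_right (s := U)))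
    refine le_trans ?_ (le_empiricalLaw μ₀ (H N) β (hU.inter hV).measurableSet
      (K := (d - c * a) * N) fun x hx => ?_)
    · calc _ = ENNReal.ofReal (Real.exp ((d - c * a) * N)) *
            ENNReal.ofReal (Real.exp (-(d * N))) := by
            rw [← ENNReal.ofReal_mul (Real.exp_pos _).le, ← Real.exp_add]
            congr 2
            ring
        _ ≤ _ := by gcongr
    · linarith [(abs_le.1 (hN x hx.1)).2]

theorem neg_coe_add_div_of_neg {D : EReal} (hD : D ≠ ⊥) (t : ℝ) {β : ℝ} (hβ : β < 0) :
    -((t : EReal) + D / (β : EReal)) = ((β * t / |β| : ℝ) : EReal) + D / ((|β| : ℝ) : EReal) := by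
  rw [abs_of_neg hβ]
  induction D with
  | bot => exact absurd rfl hD
  | top =>
    rw [EReal.top_div_of_neg_ne_bot (by exact_mod_cast hβ) (EReal.coe_ne_bot β),
      EReal.top_div_of_pos_ne_top (by exact_mod_cast neg_pos.2 hβ) (EReal.coe_ne_top _),
      EReal.coe_add_top, EReal.add_bot, EReal.neg_bot]
  | coe d =>
    rw [← EReal.coe_div, ← EReal.coe_add, ← EReal.coe_neg, ← EReal.coe_div, ← EReal.coe_add]
    congr 1
    have := hβ.ne
    field_simp
    ring

end Main

end GibbsLDP

theorem mainTheorem10 {X : Type*} [MetricSpace X] [CompactSpace X]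
    [MeasurableSpace X] [BorelSpace X]
    (μ₀ : Measure X) [IsProbabilityMeasure μ₀] (hsupp : μ₀.support = Set.univ)
    (H : (N : ℕ+) → (Fin N → X) → ℝ)
    (hsymm : ∀ (N : ℕ+) (σ : Equiv.Perm (Fin N)) (x : Fin N → X), H N (x ∘ σ) = H N x)
    (hbdd : ∃ C : ℝ, ∀ (N : ℕ+) (x : Fin N → X), |H N x / (N : ℝ)| ≤ C)
    (hequi : ∀ ε : ℝ, 0 < ε → ∃ δ : ℝ, 0 < δ ∧ ∀ (N : ℕ+) (x y : Fin N → X),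
      (1 / (N : ℝ)) * ∑ i, dist (x i) (y i) ≤ δ → |H N x - H N y| / (N : ℝ) ≤ ε)
    (b : ℕ+ → ℝ) (hbpos : ∀ N, 0 < b N) (hb : Tendsto b atTop atTop)
    (E : ProbabilityMeasure X → EReal)
    (hLDP : GibbsLDP.SatisfiesLDP atTop
      (fun N : ℕ+ => GibbsLDP.empiricalLaw μ₀ (H N) (b N)) (fun N => b N * (N : ℝ)) E)
    (β : ℝ) :
    (0 < β → GibbsLDP.SatisfiesLDP atTop
      (fun N : ℕ+ => GibbsLDP.empiricalLaw μ₀ (H N) β) (fun N => β * (N : ℝ))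
      (fun μ => E μ + GibbsLDP.relEntropy μ₀ μ / (β : EReal))) ∧
    (β < 0 → GibbsLDP.SatisfiesLDP atTop
      (fun N : ℕ+ => GibbsLDP.empiricalLaw μ₀ (H N) β) (fun N => |β| * (N : ℝ))
      (fun μ => -(E μ + GibbsLDP.relEntropy μ₀ μ / (β : EReal)))) := by
  obtain ⟨e, hE, he, hloc⟩ := GibbsLDP.exists_macroscopic_energy hsupp hbdd
    (fun m _ hε => GibbsLDP.exists_nhds_oscillation_le hsymm hequi m hε) hbpos hb hLDP
  simp_rw [hE]
  refine ⟨fun hβ => ?_, fun hβ => ?_⟩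
  · simpa [mul_div_cancel_left₀ _ hβ.ne'] using
      GibbsLDP.satisfiesLDP_empiricalLaw (μ₀ := μ₀) he hloc β hβ
  · simp_rw [fun μ => GibbsLDP.neg_coe_add_div_of_neg
      (GibbsLDP.relEntropy_ne_bot μ₀ μ) (e μ) hβ]
    exact GibbsLDP.satisfiesLDP_empiricalLaw he hloc β (abs_pos.2 hβ.ne)
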